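/- Let $(M,g)$ be a (not necessarily complete) Kähler manifold of real dimension $2m$, i.e. a smooth Riemannian manifold carrying an orthogonal integrable almost complex structure $J$ whose fundamental form $\omega(X,Y)=g(JX,Y)$ is closed. For $p\in M$, let $S^2_0(T_pM)$ be the space of trace-free symmetric $(0,2)$-tensors, and let the curvature operator of the second kind be $$\mathcal R=\operatorname{pr}_{S^2_0(T_pM)}\circ\overline R\colon S^2_0(T_pM)\to S^2_0(T_pM),\qquad (\overline R(h))_{ij}=\sum_{k,l}R_{iklj}h_{kl},$$ where indices refer to an orthonormal basis and $R_{ijij}$ is the sectional curvature of the plane spanned by $e_i,e_j$. With $\lambda_1\le\dots\le\lambda_N$ the eigenvalues of $\mathcal R$ counted with multiplicity and a real number $k>0$, $\mathcal R$ is called $k$-nonnegative if $\lambda_1+\dots+\lambda_{\lfloor k\rfloor}+(k-\lfloor k\rfloor)\lambda_{\lfloor k\rfloor+1}\ge 0$ at every point of $M$, and $k$-nonpositive if $-\mathcal R$ is $k$-nonnegative. Set $$B_m=\begin{cases}3m\,\dfrac{m+1}{m+2}&\text{if } m \text{ is even},\\[2mm] 3m\,\dfrac{(m+1)(m^2-1)}{(m+2)(m^2+1)}&\text{if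 } m\text{ is odd}.\end{cases}$$ If $\mathcal R$ is $M'$-nonnegative or $M'$-nonpositive for some real $M'$ with $0<M'<B_m$, then $(M,g)$ is flat. -/

import Mathlib

set_option maxSynthPendingDepth 3

open Module
open scoped Manifold

noncomputable section

/-! ### Local Riemannian geometry in a coordinate domain

`G : E → E →L[ℝ] E →L[ℝ] ℝ` is a metric on (an open subset of) the vector space `E`. -/

namespace LocalGeometry

variable {E : Type*} [NormedAddCommGroup E] [NormedSpace ℝ E]

/-- The Christoffel symbols of the first kind,
`(u, v, w) ↦ ½ ((D_u G)(v, w) + (D_v G)(u, w) - (D_w G)(u, v))`. -/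
def christoffelFirst (G : E → E →L[ℝ] E →L[ℝ] ℝ) (y : E) : E →L[ℝ] E →L[ℝ] E →L[ℝ] ℝ :=
  let B : E →L[ℝ] E →L[ℝ] E →L[ℝ] ℝ := fderiv ℝ G y
  let C : E →L[ℝ] E →L[ℝ] E →L[ℝ] ℝ :=
    (ContinuousLinearMap.flipₗᵢ ℝ E E ℝ).toContinuousLinearEquiv.toContinuousLinearMap.comp B.flip
  (1 / 2 : ℝ) • (B + B.flip - C)

theorem christoffelFirst_apply (G : E → E →L[ℝ] E →L[ℝ] ℝ) (y u v w : E) :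
    christoffelFirst G y u v w =
      (1 / 2) * (fderiv ℝ G y u v w + fderiv ℝ G y v u w - fderiv ℝ G y w u v) := rfl

/-- The Christoffel symbols (of the second kind) `Γ(u, v)`, determined by
`G(Γ(u, v), w) = ½ ((D_u G)(v, w) + (D_v G)(u, w) - (D_w G)(u, v))`: the Levi-Civita connection
of `G` is `∇_u V = D_u V + Γ(u, V)`. -/
def christoffel (G : E → E →L[ℝ] E →L[ℝ] ℝ) (y : E) : E →L[ℝ] E →L[ℝ] E :=
  (ContinuousLinearMap.compL ℝ E (E →L[ℝ] ℝ) E (G y).inverse).comp (christoffelFirst G y)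

theorem christoffel_apply (G : E → E →L[ℝ] E →L[ℝ] ℝ) (y u v : E) :
    christoffel G y u v = (G y).inverse (christoffelFirst G y u v) := rfl

/-- The Riemann curvature tensor of `G`,
`R(u, v) w = (D_u Γ)(v, w) - (D_v Γ)(u, w) + Γ(u, Γ(v, w)) - Γ(v, Γ(u, w))`, that is,
`R(u, v) w = ∇_u ∇_v w - ∇_v ∇_u w` for constant vector fields `u, v, w`. -/
def riemann (G : E → E →L[ℝ] E →L[ℝ] ℝ) (y : E) : E →L[ℝ] E →L[ℝ] E →L[ℝ] E :=
  fderiv ℝ (christoffel G) y - (fderiv ℝ (christoffel G) y).flip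
    + (ContinuousLinearMap.compL ℝ E E E).bilinearComp (christoffel G y) (christoffel G y)
    - ((ContinuousLinearMap.compL ℝ E E E).bilinearComp (christoffel G y) (christoffel G y)).flip

theorem riemann_apply (G : E → E →L[ℝ] E →L[ℝ] ℝ) (y u v w : E) :
    riemann G y u v w =
      fderiv ℝ (christoffel G) y u v w - fderiv ℝ (christoffel G) y v u w
        + christoffel G y u (christoffel G y v w) - christoffel G y v (christoffel G y u w) := rfl

/-- The Nijenhuis tensor `[Ju, Jv] - J[Ju, v] - J[u, Jv] - [u, v]` of a field `J` of endomorphisms,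
for constant vector fields `u, v`. -/
def nijenhuis (J : E → E →L[ℝ] E) (y u v : E) : E :=
  fderiv ℝ J y (J y u) v - fderiv ℝ J y (J y v) u + J y (fderiv ℝ J y v u) - J y (fderiv ℝ J y u v)

/-- The two-form `ω(u, v) = G(Ju, v)`. -/
def fundamentalForm (G : E → E →L[ℝ] E →L[ℝ] ℝ) (J : E → E →L[ℝ] E) (y : E) :
    E →L[ℝ] E →L[ℝ] ℝ :=
  (G y).comp (J y)

/-- The exterior derivative of a two-form `σ`, on constant vector fields `u, v, w`:
`dσ(u, v, w) = (D_u σ)(v, w) + (D_v σ)(w, u) + (D_w σ)(u, v)`. -/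
def extDerivTwoForm (σ : E → E →L[ℝ] E →L[ℝ] ℝ) (y u v w : E) : ℝ :=
  fderiv ℝ σ y u v w + fderiv ℝ σ y v w u + fderiv ℝ σ y w u v

end LocalGeometry

/-! ### The curvature operator of the second kind on an inner product space -/

namespace SecondKind

section

variable (V : Type*) [NormedAddCommGroup V] [InnerProductSpace ℝ V] [FiniteDimensional ℝ V]

/-- The trace `∑ h(e_i, e_i)` of a bilinear form over an orthonormal basis. -/
def trace : LinearMap.BilinForm ℝ V →ₗ[ℝ] ℝ where
  toFun h := ∑ i, h (stdOrthonormalBasis ℝ V i) (stdOrthonormalBasis ℝ V i)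
  map_add' h h' := by simp [Finset.sum_add_distrib]
  map_smul' c h := by simp [Finset.mul_sum]

/-- `S²₀(V)`: the space of trace-free symmetric `(0,2)`-tensors. -/
def tracelessSym : Submodule ℝ (LinearMap.BilinForm ℝ V) where
  carrier := {h | (∀ u v, h u v = h v u) ∧ trace V h = 0}
  add_mem' := by
    rintro a b ⟨ha, ha'⟩ ⟨hb, hb'⟩
    exact ⟨fun u v => by simp [ha u v, hb u v], by simp [ha', hb']⟩
  zero_mem' := ⟨fun u v => by simp, by simp⟩
  smul_mem' := by
    rintro c a ⟨ha, ha'⟩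
    exact ⟨fun u v => by simp [ha u v], by simp [ha']⟩

theorem trace_inner : trace V (innerₗ V) = (finrank ℝ V : ℝ) := by
  simp [trace]

/-- The orthogonal projection of `(0,2)`-tensors onto `S²₀(V)`: symmetrize, then remove the
trace. -/
def projTracelessSym : LinearMap.BilinForm ℝ V →ₗ[ℝ] tracelessSym V where
  toFun h :=
    ⟨(1 / 2 : ℝ) • (h + LinearMap.flip h) - (trace V h / finrank ℝ V) • innerₗ V, by
      refine ⟨fun u v => ?_, ?_⟩
      · simp [real_inner_comm u v, add_comm]
      · have hf : trace V (LinearMap.flip h) = trace V h := rfl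
        have h1 : trace V ((1 / 2 : ℝ) • (h + LinearMap.flip h) -
            (trace V h / finrank ℝ V) • innerₗ V) =
            (1 / 2) * (trace V h + trace V (LinearMap.flip h)) -
              (trace V h / finrank ℝ V) * trace V (innerₗ V) := by
          rw [LinearMap.map_sub, LinearMap.map_smul, LinearMap.map_smul, LinearMap.map_add]
          rfl
        rw [h1, hf, trace_inner]
        by_cases hn : (finrank ℝ V : ℝ) = 0
        · have hn' : finrank ℝ V = 0 := by exact_mod_cast hn
          have : IsEmpty (Fin (finrank ℝ V)) := by rw [hn']; infer_instance
          have ht : trace V h = 0 := by simp [trace]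
          simp [ht]
        · field_simp
          ring⟩
  map_add' h h' := by
    ext u v
    simp
    ring
  map_smul' c h := by
    ext u v
    simp
    ring

variable {V}

/-- The operator `(R̄ h)_{ij} = ∑ R_{iklj} h_{kl}` on `(0,2)`-tensors, in the orthonormal basis `e`,
with the convention `R_{ijkl} = ⟨R(e_i, e_j) e_l, e_k⟩` (so that `R_{ijij} > 0` on spheres):
`(R̄ h)(x, y) = ∑ ⟨R(x, e_k) y, e_l⟩ h(e_k, e_l)`. -/
def barOperator (R : V →ₗ[ℝ] V →ₗ[ℝ] V →ₗ[ℝ] V) :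
    LinearMap.BilinForm ℝ V →ₗ[ℝ] LinearMap.BilinForm ℝ V where
  toFun h := LinearMap.mk₂ ℝ
    (fun x y => ∑ k, ∑ l, inner ℝ (R x (stdOrthonormalBasis ℝ V k) y) (stdOrthonormalBasis ℝ V l) *
      h (stdOrthonormalBasis ℝ V k) (stdOrthonormalBasis ℝ V l))
    (fun x x' y => by simp [inner_add_left, add_mul, Finset.sum_add_distrib])
    (fun c x y => by simp [inner_smul_left, mul_assoc, Finset.mul_sum])
    (fun x y y' => by simp [inner_add_left, add_mul, Finset.sum_add_distrib])
    (fun c x y => by simp [inner_smul_left, mul_assoc, Finset.mul_sum])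
  map_add' h h' := by
    ext x y
    simp [mul_add, Finset.sum_add_distrib]
  map_smul' c h := by
    ext x y
    simp [mul_left_comm, Finset.mul_sum]

/-- The curvature operator of the second kind `pr ∘ R̄ : S²₀(V) → S²₀(V)` of a curvature
tensor `R`. -/
def curvatureOperator (R : V →ₗ[ℝ] V →ₗ[ℝ] V →ₗ[ℝ] V) :
    tracelessSym V →ₗ[ℝ] tracelessSym V :=
  projTracelessSym V ∘ₗ barOperator R ∘ₗ (tracelessSym V).subtype

end

section

variable {W : Type*} [AddCommGroup W] [Module ℝ W] [FiniteDimensional ℝ W]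

/-- The real eigenvalues of `T`, with multiplicity, in increasing order
(for `T` self-adjoint these are `dim W` many). -/
def eigenvalueList (T : W →ₗ[ℝ] W) : List ℝ :=
  T.charpoly.roots.sort (· ≤ ·)

/-- `T`, with eigenvalues `λ₁ ≤ λ₂ ≤ …`, is `k`-nonnegative if
`λ₁ + … + λ_⌊k⌋ + (k - ⌊k⌋) λ_{⌊k⌋ + 1} ≥ 0`. -/
def IsKNonneg (k : ℝ) (T : W →ₗ[ℝ] W) : Prop :=
  0 ≤ ((eigenvalueList T).take ⌊k⌋₊).sum + (k - ⌊k⌋₊) * (eigenvalueList T).getD ⌊k⌋₊ 0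

/-- `T` is `k`-nonpositive if `-T` is `k`-nonnegative. -/
def IsKNonpos (k : ℝ) (T : W →ₗ[ℝ] W) : Prop :=
  IsKNonneg k (-T)

end

section

variable {V : Type*} [NormedAddCommGroup V] [InnerProductSpace ℝ V] [FiniteDimensional ℝ V]

/-- The curvature operator of the second kind of `R` is `k`-nonnegative. -/
def IsKNonnegCurvature (k : ℝ) (R : V →ₗ[ℝ] V →ₗ[ℝ] V →ₗ[ℝ] V) : Prop :=
  IsKNonneg k (curvatureOperator R)

/-- The curvature operator of the second kind of `R` is `k`-nonpositive. -/
def IsKNonposCurvature (k : ℝ) (R : V →ₗ[ℝ] V →ₗ[ℝ] V →ₗ[ℝ] V) : Prop :=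
  IsKNonpos k (curvatureOperator R)

end

end SecondKind

/-! ### Riemannian and Kähler manifolds -/

namespace RiemannianGeometry

open Bundle
open scoped ContDiff

variable {E : Type*} [NormedAddCommGroup E] [NormedSpace ℝ E] [FiniteDimensional ℝ E]
  {M : Type*} [TopologicalSpace M] [ChartedSpace E M]

instance (x : M) : FiniteDimensional ℝ (TangentSpace 𝓘(ℝ, E) x) :=
  inferInstanceAs (FiniteDimensional ℝ E)

/-- The endomorphism field `J` of the tangent bundle in the chart `φ` at `x₀`, as a function on the
target of `φ`: `y ↦ dφ ∘ J ∘ d(φ⁻¹)_y`. -/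
def chartEndo (J : (x : M) → TangentSpace 𝓘(ℝ, E) x →L[ℝ] TangentSpace 𝓘(ℝ, E) x) (x₀ : M)
    (y : E) : E →L[ℝ] E :=
  let p : M := (extChartAt 𝓘(ℝ, E) x₀).symm y
  let A : TangentSpace 𝓘(ℝ, E) p →L[ℝ] E :=
    mfderiv 𝓘(ℝ, E) 𝓘(ℝ, E) (extChartAt 𝓘(ℝ, E) x₀) p
  let B : E →L[ℝ] TangentSpace 𝓘(ℝ, E) p :=
    mfderiv 𝓘(ℝ, E) 𝓘(ℝ, E) (extChartAt 𝓘(ℝ, E) x₀).symm y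
  A.comp ((J p).comp B)

variable [IsManifold 𝓘(ℝ, E) ∞ M]

/-- The field `J` of endomorphisms of the tangent spaces is smooth. -/
def IsSmoothEndo (J : (x : M) → TangentSpace 𝓘(ℝ, E) x →L[ℝ] TangentSpace 𝓘(ℝ, E) x) : Prop :=
  ContMDiff 𝓘(ℝ, E) (𝓘(ℝ, E).prod 𝓘(ℝ, E →L[ℝ] E)) ∞
    (fun x => TotalSpace.mk' (E →L[ℝ] E)
      (E := fun x : M => TangentSpace 𝓘(ℝ, E) x →L[ℝ] TangentSpace 𝓘(ℝ, E) x) x (J x))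

variable [RiemannianBundle (fun x : M => TangentSpace 𝓘(ℝ, E) x)]

/-- The metric in the chart `φ` at `x₀`, as a function on the target of `φ`:
`G(y)(u, v) = ⟨d(φ⁻¹)_y u, d(φ⁻¹)_y v⟩`. -/
def chartMetric (x₀ : M) (y : E) : E →L[ℝ] E →L[ℝ] ℝ :=
  let p : M := (extChartAt 𝓘(ℝ, E) x₀).symm y
  let B : E →L[ℝ] TangentSpace 𝓘(ℝ, E) p :=
    mfderiv 𝓘(ℝ, E) 𝓘(ℝ, E) (extChartAt 𝓘(ℝ, E) x₀).symm y
  (innerSL ℝ (E := TangentSpace 𝓘(ℝ, E) p)).bilinearComp B B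

/-- The Riemann curvature tensor at `x`, computed in the chart at `x`. -/
def curvatureTensor (x : M) :
    TangentSpace 𝓘(ℝ, E) x →ₗ[ℝ] TangentSpace 𝓘(ℝ, E) x →ₗ[ℝ]
      TangentSpace 𝓘(ℝ, E) x →ₗ[ℝ] TangentSpace 𝓘(ℝ, E) x :=
  let y : E := extChartAt 𝓘(ℝ, E) x x
  let A : TangentSpace 𝓘(ℝ, E) x →ₗ[ℝ] E :=
    (mfderiv 𝓘(ℝ, E) 𝓘(ℝ, E) (extChartAt 𝓘(ℝ, E) x) x).toLinearMap
  let B : E →ₗ[ℝ] TangentSpace 𝓘(ℝ, E) x :=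
    (mfderiv 𝓘(ℝ, E) 𝓘(ℝ, E) (extChartAt 𝓘(ℝ, E) x).symm y).toLinearMap
  LinearMap.mk₂ ℝ
    (fun u v => B ∘ₗ (LocalGeometry.riemann (chartMetric x) y (A u) (A v)).toLinearMap ∘ₗ A)
    (fun u u' v => by ext w; simp)
    (fun c u v => by ext w; simp)
    (fun u v v' => by ext w; simp)
    (fun c u v => by ext w; simp)

variable (E M)

/-- The curvature operator of the second kind is `k`-nonnegative (at every point of `M`). -/
def HasKNonnegSecondKind (k : ℝ) : Prop :=
  ∀ x : M, SecondKind.IsKNonnegCurvature k (curvatureTensor (E := E) x)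

/-- The curvature operator of the second kind is `k`-nonpositive (at every point of `M`). -/
def HasKNonposSecondKind (k : ℝ) : Prop :=
  ∀ x : M, SecondKind.IsKNonposCurvature k (curvatureTensor (E := E) x)

/-- A Riemannian manifold is flat if its curvature tensor vanishes. -/
def IsFlat : Prop := ∀ x : M, curvatureTensor (E := E) x = 0

/-- A Riemannian manifold is Kähler if it has a smooth almost complex structure `J` which is
orthogonal and integrable (its Nijenhuis tensor vanishes), and whose fundamental two-form
`ω(u, v) = ⟨Ju, v⟩` is closed. -/
def IsKaehler : Prop :=
  ∃ J : (x : M) → TangentSpace 𝓘(ℝ, E) x →L[ℝ] TangentSpace 𝓘(ℝ, E) x,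
    IsSmoothEndo J ∧
    (∀ x u, J x (J x u) = -u) ∧
    (∀ x u v, inner ℝ (J x u) (J x v) = inner ℝ u v) ∧
    (∀ x₀ : M, ∀ y ∈ (extChartAt 𝓘(ℝ, E) x₀).target, ∀ u v : E,
      LocalGeometry.nijenhuis (chartEndo J x₀) y u v = 0) ∧
    (∀ x₀ : M, ∀ y ∈ (extChartAt 𝓘(ℝ, E) x₀).target, ∀ u v w : E,
      LocalGeometry.extDerivTwoForm
        (LocalGeometry.fundamentalForm (chartMetric x₀) (chartEndo J x₀)) y u v w = 0)

end RiemannianGeometry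

/-- `3m(m+1)/(m+2)` for `m` even, `3m(m+1)(m²-1)/((m+2)(m²+1))` for `m` odd. -/
def kaehlerBound (m : ℕ) : ℝ :=
  if Even m then 3 * (m : ℝ) * ((m + 1) / (m + 2))
  else 3 * (m : ℝ) * (((m + 1) * ((m : ℝ) ^ 2 - 1)) / ((m + 2) * ((m : ℝ) ^ 2 + 1)))

end

open Bundle
open scoped ContDiff

/-! The argument is pointwise. Let `T` be the curvature operator of the second kind at a point and
`P` the involution h ↦ h(J·,J·) of the trace-free symmetric tensors. In real dimension 2m its +1 and
−1 eigenspaces have dimensions m² − 1 and m² + m. With s the scalar curvature, tr T = s(m+1)/(2m),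
and the Kähler symmetries give tr(PT) = −s(3m−1)/(2m). Hence A = c·1 + d·P, with c + d = 1 and
c(m+1) = d(3m−1), satisfies tr(AT) = 0 whatever R is. For m ≥ 2 its eigenvalues 1 and c − d =
(m−1)/(2m) lie in (0,1], and tr A = 3(m²−1)/2, which is at least the bound of the theorem.

The rest is linear algebra (`IsKNonneg.eq_zero_of_isSymmetric`): in an eigenbasis of `T`, tr(AT) is
a weighted sum of the eigenvalues with weights in (0,1] of total tr A > k. Such a sum can vanish for
a k-nonnegative `T` only if `T` = 0. Changing the sign of `T` covers the nonpositive case, and `T` =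
0 forces R = 0 because `T` determines all sectional curvatures.

What geometry must supply is `IsKaehlerCurvature` for the tensor computed in a chart: dω = 0 and
vanishing Nijenhuis tensor make J parallel, so R commutes with J. -/

namespace SecondKind

/-! ### Weighted traces of k-nonnegative operators -/

/-- Entries from position n on contribute zero. The left side, for a fixed threshold, no longer
depends on the order of the list, so eigenvalues can later be indexed by any eigenbasis. -/
theorem sum_map_max_sub_getElem {l : List ℝ} (hl : l.Pairwise (· ≤ ·)) {n : ℕ}
    (hn : n < l.length) :
    (l.map fun x => max (l[n] - x) 0).sum = n * l[n] - (l.take n).sum := by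
  set μ := l[n] with hμ
  have h1 : ∀ x ∈ l.take n, x ≤ μ := by
    intro x hx
    obtain ⟨i, hi, rfl⟩ := List.mem_take_iff_getElem.1 hx
    exact List.pairwise_iff_getElem.1 hl i n _ hn (by omega)
  have h2 : ∀ x ∈ l.drop n, μ ≤ x := by
    intro x hx
    obtain ⟨i, hi, rfl⟩ := List.mem_drop_iff_getElem.1 hx
    rcases Nat.eq_zero_or_pos i with rfl | hi0
    · simp [hμ]
    · exact List.pairwise_iff_getElem.1 hl n (n + i) hn (by omega) (by omega)
  have e1 : ((l.take n).map fun x => max (μ - x) 0) = (l.take n).map fun x => μ - x :=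
    List.map_congr_left fun x hx => max_eq_left (sub_nonneg.2 (h1 x hx))
  have e2 : ((l.drop n).map fun x => max (μ - x) 0) = (l.drop n).map fun _ => (0 : ℝ) :=
    List.map_congr_left fun x hx => max_eq_right (sub_nonpos.2 (h2 x hx))
  have e3 : ∀ s : List ℝ, (s.map fun x => μ - x).sum = s.length * μ - s.sum := by
    intro s
    induction s with
    | nil => simp
    | cons a s ih => simp [ih]; ring
  conv_lhs => rw [← List.take_append_drop n l]
  rw [List.map_append, List.sum_append, e1, e2, e3]
  simp [min_eq_left hn.le]

/-- The sum of the `k` lowest eigenvalues is `k μ - ∑ max (μ - λ_i) 0`, where `μ` is the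
`(⌊k⌋ + 1)`-st eigenvalue. -/
theorem IsKNonneg.exists_threshold {W : Type*} [AddCommGroup W] [Module ℝ W]
    [FiniteDimensional ℝ W] {T : W →ₗ[ℝ] W} {n : ℕ} {lam : Fin n → ℝ}
    (hroots : T.charpoly.roots = Finset.univ.val.map lam) {k : ℝ} (hk : 0 < k) (hkn : k < n)
    (h : IsKNonneg k T) :
    ∃ μ : ℝ, 0 ≤ μ ∧ ∑ i, max (μ - lam i) 0 ≤ k * μ := by
  have hsort : (eigenvalueList T).Pairwise (· ≤ ·) := Multiset.pairwise_sort _ _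
  have hcoe : ((eigenvalueList T : List ℝ) : Multiset ℝ) = Finset.univ.val.map lam := by
    rw [← hroots]; exact Multiset.sort_eq _ _
  have hlen : (eigenvalueList T).length = n := by
    have := congrArg Multiset.card hcoe
    simpa using this
  have hfl : ⌊k⌋₊ < (eigenvalueList T).length := by
    rw [hlen]; exact (Nat.floor_lt hk.le).2 hkn
  have hsum := sum_map_max_sub_getElem hsort hfl
  have htot : ((eigenvalueList T).map fun x => max ((eigenvalueList T)[⌊k⌋₊] - x) 0).sum =
      ∑ i, max ((eigenvalueList T)[⌊k⌋₊] - lam i) 0 := by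
    rw [← Multiset.sum_coe, ← Multiset.map_coe, hcoe, Multiset.map_map]
    rfl
  unfold IsKNonneg at h
  -- Since k < n, the index ⌊k⌋ is in range and the default value 0 is never read.
  rw [List.getD_eq_getElem _ _ hfl] at h
  set μ := (eigenvalueList T)[⌊k⌋₊]
  have hle : ∑ i, max (μ - lam i) 0 ≤ k * μ := by
    rw [← htot, hsum]; linarith
  refine ⟨μ, ?_, hle⟩
  have h0 : 0 ≤ ∑ i, max (μ - lam i) 0 := Finset.sum_nonneg fun i _ => le_max_right _ _
  exact nonneg_of_mul_nonneg_right (h0.trans hle) hk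

/-- A `k`-nonnegative self-adjoint operator `T` vanishes if `tr (A T) = 0` for some operator `A`
with `0 < A ≤ 1` and `tr A > k`. -/
theorem IsKNonneg.eq_zero_of_isSymmetric {W : Type*} [NormedAddCommGroup W]
    [InnerProductSpace ℝ W] [FiniteDimensional ℝ W] {T A : W →ₗ[ℝ] W} (hT : T.IsSymmetric)
    (hA0 : ∀ v, v ≠ 0 → 0 < inner ℝ (A v) v) (hA1 : ∀ v, inner ℝ (A v) v ≤ inner ℝ v v)
    {k : ℝ} (hk : 0 < k) (hkA : k < LinearMap.trace ℝ W A)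
    (htr : LinearMap.trace ℝ W (A ∘ₗ T) = 0) (h : IsKNonneg k T) : T = 0 := by
  set lam := hT.eigenvalues rfl with hlam
  set b := hT.eigenvectorBasis rfl with hb
  have hTb : ∀ i, T (b i) = lam i • b i := fun i => by
    exact hT.apply_eigenvectorBasis rfl i
  -- Only the diagonal of `A` in an eigenbasis of `T` matters; `A` and `T` need not commute.
  set w : Fin (finrank ℝ W) → ℝ := fun i => inner ℝ (A (b i)) (b i) with hw
  have hw0 : ∀ i, 0 < w i := fun i => hA0 _ (b.orthonormal.ne_zero i)
  have hw1 : ∀ i, w i ≤ 1 := fun i => by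
    have := hA1 (b i)
    rwa [real_inner_self_eq_norm_sq, b.orthonormal.1 i, one_pow] at this
  have htrA : LinearMap.trace ℝ W A = ∑ i, w i := by
    rw [LinearMap.trace_eq_sum_inner A b]
    exact Finset.sum_congr rfl fun i _ => real_inner_comm _ _
  have htrAT : ∑ i, lam i * w i = 0 := by
    rw [← htr, LinearMap.trace_eq_sum_inner _ b]
    refine Finset.sum_congr rfl fun i _ => ?_
    rw [LinearMap.comp_apply, hTb, map_smul, inner_smul_right, real_inner_comm]
  have hkn : k < (finrank ℝ W : ℕ) := by
    refine hkA.trans_le ?_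
    rw [htrA]
    calc ∑ i, w i ≤ ∑ _i : Fin (finrank ℝ W), (1 : ℝ) := Finset.sum_le_sum fun i _ => hw1 i
      _ = _ := by simp
  have hroots : T.charpoly.roots = Finset.univ.val.map lam := by
    simpa [Function.comp_def] using hT.roots_charpoly_eq_eigenvalues rfl
  obtain ⟨μ, hμ0, hμ⟩ := h.exists_threshold hroots hk hkn
  -- As 0 < w ≤ 1, (μ − λ)w ≤ max(μ − λ, 0).
  have hlow : ∀ i, μ * w i - max (μ - lam i) 0 ≤ lam i * w i := fun i => by
    have h1 : μ - lam i ≤ max (μ - lam i) 0 := le_max_left _ _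
    have h2 : 0 ≤ max (μ - lam i) 0 := le_max_right _ _
    nlinarith [hw0 i, hw1 i]
  have hsum := Finset.sum_le_sum fun i (_ : i ∈ Finset.univ) => hlow i
  rw [htrAT, Finset.sum_sub_distrib, ← Finset.mul_sum, ← htrA] at hsum
  -- Summation and the threshold inequality give μ(tr A − k) ≤ 0, while μ ≥ 0 and tr A > k.
  have hμz : μ = 0 := by nlinarith
  subst hμz
  have hmax : ∀ i, 0 ≤ lam i := fun i => by
    have h1 : max (0 - lam i) 0 ≤ ∑ i, max (0 - lam i) 0 :=
      Finset.single_le_sum (f := fun i => max (0 - lam i) 0) (fun i _ => le_max_right _ _)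
        (Finset.mem_univ i)
    have h2 : 0 - lam i ≤ max (0 - lam i) 0 := le_max_left _ _
    linarith
  have hz : ∀ i, lam i = 0 := fun i => by
    have := (Finset.sum_eq_zero_iff_of_nonneg
      fun i _ => mul_nonneg (hmax i) (hw0 i).le).1 htrAT i (Finset.mem_univ i)
    exact (mul_eq_zero.1 this).resolve_right (hw0 i).ne'
  refine b.toBasis.ext fun i => ?_
  simp [hTb, hz]

/-- `IsKNonneg.eq_zero_of_isSymmetric` for an inner product given as a bilinear form. -/
theorem IsKNonneg.eq_zero {W : Type*} [AddCommGroup W] [Module ℝ W]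
    [FiniteDimensional ℝ W] (B : LinearMap.BilinForm ℝ W) (hBs : ∀ u v, B u v = B v u)
    (hBp : ∀ v, v ≠ 0 → 0 < B v v) {T A : W →ₗ[ℝ] W} (hT : ∀ u v, B (T u) v = B u (T v))
    (hA0 : ∀ v, v ≠ 0 → 0 < B (A v) v) (hA1 : ∀ v, B (A v) v ≤ B v v)
    {k : ℝ} (hk : 0 < k) (hkA : k < LinearMap.trace ℝ W A)
    (htr : LinearMap.trace ℝ W (A ∘ₗ T) = 0) (h : IsKNonneg k T) : T = 0 := by
  have hB0 : ∀ v, 0 ≤ B v v := fun v => by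
    rcases eq_or_ne v 0 with rfl | hv
    · simp
    · exact (hBp v hv).le
  -- Traces and k-nonnegativity are purely algebraic, so any norm may be put on `W`.
  let core : InnerProductSpace.Core ℝ W :=
    { inner := fun u v => B u v
      conj_inner_symm := fun u v => by simp [hBs u v]
      re_inner_nonneg := fun v => by simpa using hB0 v
      add_left := fun u v w => by simp
      smul_left := fun u v r => by simp
      definite := fun v hv => by
        by_contra hne
        exact (hBp v hne).ne' hv }
  let _ : NormedAddCommGroup W := core.toNormedAddCommGroup
  let _ : InnerProductSpace ℝ W := InnerProductSpace.ofCore core.toCore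
  exact IsKNonneg.eq_zero_of_isSymmetric (T := T) (A := A) hT hA0 hA1 hk hkA htr h

theorem IsKNonpos.eq_zero {W : Type*} [AddCommGroup W] [Module ℝ W]
    [FiniteDimensional ℝ W] (B : LinearMap.BilinForm ℝ W) (hBs : ∀ u v, B u v = B v u)
    (hBp : ∀ v, v ≠ 0 → 0 < B v v) {T A : W →ₗ[ℝ] W} (hT : ∀ u v, B (T u) v = B u (T v))
    (hA0 : ∀ v, v ≠ 0 → 0 < B (A v) v) (hA1 : ∀ v, B (A v) v ≤ B v v)
    {k : ℝ} (hk : 0 < k) (hkA : k < LinearMap.trace ℝ W A)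
    (htr : LinearMap.trace ℝ W (A ∘ₗ T) = 0) (h : IsKNonpos k T) : T = 0 :=
  neg_eq_zero.1 (IsKNonneg.eq_zero B hBs hBp (T := -T) (fun u v => by simp [hT])
    hA0 hA1 hk hkA (by rw [LinearMap.comp_neg, map_neg, htr, neg_zero]) h)

/-! ### Bilinear forms in orthonormal bases -/

section

variable {V : Type*} [NormedAddCommGroup V] [InnerProductSpace ℝ V] {ι ι' : Type*} [Fintype ι]
  [Fintype ι']

theorem sum_sum_inner_mul_inner_mul (b : OrthonormalBasis ι ℝ V) (f : LinearMap.BilinForm ℝ V)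
    (x y : V) : ∑ i, ∑ j, inner ℝ x (b i) * inner ℝ y (b j) * f (b i) (b j) = f x y := by
  conv_rhs => rw [← b.sum_repr' x, ← b.sum_repr' y]
  simp only [map_sum, map_smul, LinearMap.sum_apply, LinearMap.smul_apply, smul_eq_mul,
    Finset.mul_sum]
  rw [Finset.sum_comm]
  refine Finset.sum_congr rfl fun i _ => Finset.sum_congr rfl fun j _ => ?_
  rw [real_inner_comm x, real_inner_comm y]
  ring

/-- The trace of a bilinear form does not depend on the orthonormal basis. -/
theorem sum_apply_self_eq (b : OrthonormalBasis ι ℝ V) (b' : OrthonormalBasis ι' ℝ V)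
    (f : LinearMap.BilinForm ℝ V) : ∑ i, f (b i) (b i) = ∑ i, f (b' i) (b' i) := by
  classical
  calc ∑ i, f (b i) (b i)
      = ∑ i, ∑ j, ∑ l, inner ℝ (b i) (b' j) * inner ℝ (b i) (b' l) * f (b' j) (b' l) :=
        Finset.sum_congr rfl fun i _ => (sum_sum_inner_mul_inner_mul b' f _ _).symm
    _ = ∑ j, ∑ l, (∑ i, inner ℝ (b' j) (b i) * inner ℝ (b i) (b' l)) * f (b' j) (b' l) := by
        rw [Finset.sum_comm]
        refine Finset.sum_congr rfl fun j _ => ?_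
        rw [Finset.sum_comm]
        refine Finset.sum_congr rfl fun l _ => ?_
        rw [Finset.sum_mul]
        exact Finset.sum_congr rfl fun i _ => by rw [real_inner_comm (b i) (b' j)]
    _ = ∑ j, f (b' j) (b' j) := by
        refine Finset.sum_congr rfl fun j _ => ?_
        rw [Finset.sum_eq_single j]
        · simp [b.sum_inner_mul_inner]
        · intro l _ hl
          rw [b.sum_inner_mul_inner, orthonormal_iff_ite.1 b'.orthonormal, if_neg hl.symm, zero_mul]
        · simp

/-- The bilinear form `(u, v) ↦ ⟨x, u⟩ ⟨y, v⟩`. -/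
noncomputable def innerTensor (x y : V) : LinearMap.BilinForm ℝ V :=
  LinearMap.BilinForm.linMulLin (innerₗ V x) (innerₗ V y)

@[simp]
theorem innerTensor_apply (x y u v : V) : innerTensor x y u v = inner ℝ x u * inner ℝ y v := rfl

/-- The tensors e_i ⊗ e_j form a basis whose coordinate functions are evaluation at (e_i, e_j).
Every trace below becomes a double sum in this way. -/
theorem trace_bilinForm_eq_sum (b : OrthonormalBasis ι ℝ V)
    (F : LinearMap.BilinForm ℝ V →ₗ[ℝ] LinearMap.BilinForm ℝ V) :
    LinearMap.trace ℝ _ F = ∑ i, ∑ j, F (innerTensor (b i) (b j)) (b i) (b j) := by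
  classical
  have : FiniteDimensional ℝ V := b.toBasis.finiteDimensional_of_finite
  let B : Basis (ι × ι) ℝ (LinearMap.BilinForm ℝ V) :=
    (Matrix.stdBasis ℝ ι ι).map (LinearMap.BilinForm.toMatrix b.toBasis).symm
  have hB : ∀ i j, B (i, j) = innerTensor (b i) (b j) := fun i j => by
    rw [Basis.map_apply, LinearEquiv.symm_apply_eq, Matrix.stdBasis_eq_single]
    ext k l
    simp [LinearMap.BilinForm.toMatrix_apply, orthonormal_iff_ite.1 b.orthonormal,
      Matrix.single_apply, ite_and]
    split_ifs <;> rfl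
  have hr : ∀ f p, B.repr f p = f (b p.1) (b p.2) := fun f p => by
    have h : (Matrix.stdBasis ℝ ι ι).repr (LinearMap.BilinForm.toMatrix b.toBasis f) p =
        LinearMap.BilinForm.toMatrix b.toBasis f p.1 p.2 := by
      simp [Matrix.stdBasis]
    simpa [B, LinearMap.BilinForm.toMatrix_apply] using h
  rw [LinearMap.trace_eq_matrix_trace ℝ B, Matrix.trace, Fintype.sum_prod_type]
  refine Finset.sum_congr rfl fun i _ => Finset.sum_congr rfl fun j _ => ?_
  rw [Matrix.diag_apply, LinearMap.toMatrix_apply, hr, hB]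

end

/-! ### Algebra of Kähler curvature tensors -/

variable {V : Type*} [NormedAddCommGroup V] [InnerProductSpace ℝ V]

/-- The symmetries of the curvature tensor `R` of a Kähler metric with complex structure `J`. -/
structure IsKaehlerCurvature (R : V →ₗ[ℝ] V →ₗ[ℝ] V →ₗ[ℝ] V) (J : V →ₗ[ℝ] V) : Prop where
  antisymm : ∀ u v w, R u v w = -R v u w
  skew : ∀ u v w z, inner ℝ (R u v w) z = -inner ℝ (R u v z) w
  bianchi : ∀ u v w, R u v w + R v w u + R w u v = 0
  sq : ∀ u, J (J u) = -u
  inner_map : ∀ u v, inner ℝ (J u) (J v) = inner ℝ u v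
  comm : ∀ u v w, R u v (J w) = J (R u v w)

namespace IsKaehlerCurvature

variable {R : V →ₗ[ℝ] V →ₗ[ℝ] V →ₗ[ℝ] V} {J : V →ₗ[ℝ] V}

theorem inner_left (h : IsKaehlerCurvature R J) (u v : V) :
    inner ℝ (J u) v = -inner ℝ u (J v) := by
  rw [← h.inner_map u, h.sq, inner_neg_right]
  simp

theorem inner_self (h : IsKaehlerCurvature R J) (u : V) : inner ℝ u (J u) = 0 := by
  have := h.inner_left u u
  rw [real_inner_comm] at this
  linarith

theorem apply_self (h : IsKaehlerCurvature R J) (u w : V) : R u u w = 0 := by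
  have := h.antisymm u u w
  have h2 : (2 : ℝ) • R u u w = 0 := by rw [two_smul]; nth_rewrite 1 [this]; simp
  simpa using h2

/-- The classical octahedron argument: add the four cyclic Bianchi identities and cancel by the skew
symmetries. -/
theorem pair_symm (h : IsKaehlerCurvature R J) (u v w z : V) :
    inner ℝ (R u v w) z = inner ℝ (R w z u) v := by
  have hb : ∀ a b c d : V,
      inner ℝ (R a b c) d + inner ℝ (R b c a) d + inner ℝ (R c a b) d = 0 := fun a b c d => by
    rw [← inner_add_left, ← inner_add_left, h.bianchi, inner_zero_left]
  have ha : ∀ a b c d : V, inner ℝ (R a b c) d = -inner ℝ (R b a c) d := fun a b c d => by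
    rw [h.antisymm, inner_neg_left]
  have hs := h.skew
  have := hb u v w z; have := hb v w z u; have := hb w z u v; have := hb z u v w
  have := hs u v w z; have := hs v w u z; have := hs w u v z
  have := hs v w z u; have := hs w z v u; have := hs z v w u
  have := hs w z u v; have := hs z u w v; have := hs u w z v
  have := hs z u v w; have := hs u v z w; have := hs v z u w
  have := ha u w z v; have := ha v z u w; have := ha u w v z; have := ha v z w u
  linarith

/-- A curvature tensor with vanishing sectional curvatures is zero. -/
theorem eq_zero_of_sectional (h : IsKaehlerCurvature R J)
    (hsec : ∀ x y, inner ℝ x y = 0 → inner ℝ (R x y y) x = 0) : R = 0 := by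
  have h1 : ∀ x y, inner ℝ (R x y y) x = 0 := fun x y => by
    rcases eq_or_ne y 0 with rfl | hy
    · simp
    have hy' : inner ℝ y y ≠ 0 := inner_self_ne_zero.2 hy
    set c : ℝ := inner ℝ x y / inner ℝ y y
    -- Removing the component of x along y does not change ⟨R(x,y)y,x⟩.
    have hz := hsec (x - c • y) y (by
      rw [inner_sub_left, inner_smul_left, starRingEnd_apply, star_trivial,
        div_mul_cancel₀ _ hy', sub_self])
    have hyy : inner ℝ (R x y y) y = 0 := by
      have := h.skew x y y y
      linarith
    simpa [inner_sub_right, inner_smul_right, h.apply_self, hyy] using hz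
  -- Polarization in x; `h3` then polarizes in y. After that all three slots alternate and Bianchi
  -- reads 3R = 0.
  have h2 : ∀ x y, R x y y = 0 := fun x y => by
    refine ext_inner_right ℝ fun z => ?_
    have h3 := h1 (x + z) y
    simp only [map_add, LinearMap.add_apply, inner_add_left, inner_add_right, h1] at h3
    have h4 : inner ℝ (R z y y) x = inner ℝ (R x y y) z := by
      rw [h.pair_symm z y y x, h.antisymm, inner_neg_left, h.skew, neg_neg]
    rw [inner_zero_left]
    linarith
  have h3 : ∀ x y z, R x y z = -R x z y := fun x y z => by
    have := h2 x (y + z)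
    simp only [map_add, LinearMap.add_apply, h2, zero_add, add_zero] at this
    exact eq_neg_of_add_eq_zero_right this
  ext x y z
  have h4 : R y z x = R x y z := by rw [h3 y z x, h.antisymm y x z, neg_neg]
  have h5 : R z x y = R x y z := by rw [h.antisymm z x y, h3 x z y, neg_neg]
  have h6 := h.bianchi x y z
  rw [h4, h5] at h6
  have h7 : (3 : ℝ) • R x y z = 0 := by rw [← h6]; module
  simpa using h7

variable [FiniteDimensional ℝ V]

/-- The isometry underlying the complex structure. -/
noncomputable def isometryEquiv (h : IsKaehlerCurvature R J) : V ≃ₗᵢ[ℝ] V :=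
  (J.isometryOfInner h.inner_map).toLinearIsometryEquiv rfl

@[simp]
theorem isometryEquiv_apply (h : IsKaehlerCurvature R J) (u : V) : h.isometryEquiv u = J u := rfl

theorem sum_apply_map_map {ι : Type*} [Fintype ι] (h : IsKaehlerCurvature R J)
    (b : OrthonormalBasis ι ℝ V) (f : LinearMap.BilinForm ℝ V) :
    ∑ i, f (J (b i)) (J (b i)) = ∑ i, f (b i) (b i) := by
  simpa using sum_apply_self_eq (b.map h.isometryEquiv) b f

end IsKaehlerCurvature

/-! ### The inner product on tensors and self-adjointness -/

variable [FiniteDimensional ℝ V]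

variable (V) in
/-- The inner product `∑ h(e_i, e_j) h'(e_i, e_j)` of bilinear forms. -/
noncomputable def formInner :
    LinearMap.BilinForm ℝ V →ₗ[ℝ] LinearMap.BilinForm ℝ V →ₗ[ℝ] ℝ :=
  LinearMap.mk₂ ℝ (fun h h' => ∑ i, ∑ j,
      h (stdOrthonormalBasis ℝ V i) (stdOrthonormalBasis ℝ V j) *
      h' (stdOrthonormalBasis ℝ V i) (stdOrthonormalBasis ℝ V j))
    (fun h₁ h₂ h' => by simp [add_mul, Finset.sum_add_distrib])
    (fun c h h' => by simp [Finset.mul_sum, mul_assoc])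
    (fun h h₁ h₂ => by simp [mul_add, Finset.sum_add_distrib])
    (fun c h h' => by simp [Finset.mul_sum, mul_left_comm])

theorem formInner_apply (h h' : LinearMap.BilinForm ℝ V) : formInner V h h' = ∑ i, ∑ j,
    h (stdOrthonormalBasis ℝ V i) (stdOrthonormalBasis ℝ V j) *
      h' (stdOrthonormalBasis ℝ V i) (stdOrthonormalBasis ℝ V j) := rfl

theorem formInner_comm (h h' : LinearMap.BilinForm ℝ V) : formInner V h h' = formInner V h' h := by
  simp only [formInner_apply, mul_comm]

theorem formInner_self_pos {h : LinearMap.BilinForm ℝ V} (hh : h ≠ 0) : 0 < formInner V h h := by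
  have hnn : ∀ i j, 0 ≤ h (stdOrthonormalBasis ℝ V i) (stdOrthonormalBasis ℝ V j) *
      h (stdOrthonormalBasis ℝ V i) (stdOrthonormalBasis ℝ V j) := fun i j => mul_self_nonneg _
  rw [formInner_apply]
  refine lt_of_le_of_ne (Finset.sum_nonneg fun i _ => Finset.sum_nonneg fun j _ => hnn i j) ?_
  intro h0
  apply hh
  refine LinearMap.BilinForm.ext_basis (stdOrthonormalBasis ℝ V).toBasis fun i j => ?_
  have h1 := (Finset.sum_eq_zero_iff_of_nonneg fun i _ => Finset.sum_nonneg fun j _ => hnn i j).1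
    h0.symm i (Finset.mem_univ i)
  have h2 := (Finset.sum_eq_zero_iff_of_nonneg fun j _ => hnn i j).1 h1 j (Finset.mem_univ j)
  simpa using h2

theorem formInner_self_nonneg (h : LinearMap.BilinForm ℝ V) : 0 ≤ formInner V h h :=
  formInner_apply h h ▸ Finset.sum_nonneg fun _ _ => Finset.sum_nonneg fun _ _ => mul_self_nonneg _

theorem formInner_flip (h h' : LinearMap.BilinForm ℝ V) :
    formInner V (LinearMap.flip h) h' = formInner V h (LinearMap.flip h') := by
  simp only [formInner_apply]
  rw [Finset.sum_comm]
  rfl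

theorem formInner_innerₗ (h : LinearMap.BilinForm ℝ V) :
    formInner V (innerₗ V) h = trace V h := by
  classical
  simp only [formInner_apply, innerₗ_apply_apply, trace,
    orthonormal_iff_ite.1 (stdOrthonormalBasis ℝ V).orthonormal]
  simp

theorem formInner_innerTensor (h : LinearMap.BilinForm ℝ V) (x y : V) :
    formInner V h (innerTensor x y) = h x y := by
  rw [← sum_sum_inner_mul_inner_mul (stdOrthonormalBasis ℝ V) h x y, formInner_apply]
  refine Finset.sum_congr rfl fun i _ => Finset.sum_congr rfl fun j _ => ?_
  rw [innerTensor_apply, mul_comm]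

theorem projTracelessSym_coe (f : LinearMap.BilinForm ℝ V) (u v : V) :
    (projTracelessSym V f : LinearMap.BilinForm ℝ V) u v =
      (1 / 2) * (f u v + f v u) - trace V f / finrank ℝ V * inner ℝ u v := rfl

theorem projTracelessSym_comp_subtype :
    projTracelessSym V ∘ₗ (tracelessSym V).subtype = LinearMap.id := by
  ext h u v
  rw [LinearMap.comp_apply, projTracelessSym_coe]
  simp only [Submodule.subtype_apply, LinearMap.id_apply, h.2.2, h.2.1 v u]
  ring

/-- The projection discards an antisymmetric part and a multiple of the metric, both orthogonal to
trace-free symmetric tensors. -/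
theorem formInner_projTracelessSym (f : LinearMap.BilinForm ℝ V) (h : tracelessSym V) :
    formInner V (projTracelessSym V f : LinearMap.BilinForm ℝ V) h = formInner V f h := by
  have e : (projTracelessSym V f : LinearMap.BilinForm ℝ V) =
      (1 / 2 : ℝ) • (f + LinearMap.flip f) - (trace V f / finrank ℝ V) • innerₗ V := rfl
  have hf : LinearMap.flip (h : LinearMap.BilinForm ℝ V) = h := by
    ext u v; exact h.2.1 v u
  rw [e]
  simp only [map_sub, map_smul, map_add, LinearMap.sub_apply, LinearMap.smul_apply,
    LinearMap.add_apply, formInner_flip, formInner_innerₗ, hf, h.2.2, smul_eq_mul]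
  ring

theorem barOperator_apply (R : V →ₗ[ℝ] V →ₗ[ℝ] V →ₗ[ℝ] V) (h : LinearMap.BilinForm ℝ V)
    (x y : V) : barOperator R h x y = ∑ k, ∑ l,
      inner ℝ (R x (stdOrthonormalBasis ℝ V k) y) (stdOrthonormalBasis ℝ V l) *
        h (stdOrthonormalBasis ℝ V k) (stdOrthonormalBasis ℝ V l) := rfl

theorem barOperator_innerTensor (R : V →ₗ[ℝ] V →ₗ[ℝ] V →ₗ[ℝ] V) (a b x y : V) :
    barOperator R (innerTensor a b) x y = inner ℝ (R x a y) b := by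
  let f : LinearMap.BilinForm ℝ V := LinearMap.mk₂ ℝ (fun k l => inner ℝ (R x k y) l)
    (by simp [inner_add_left]) (by simp [inner_smul_left]) (by simp [inner_add_right])
    (by simp [inner_smul_right])
  exact formInner_innerTensor f a b

/-- The kernel ⟨R(x,k)y,l⟩ is unchanged when (x,y) and (k,l) are exchanged, by the two skew
symmetries. -/
theorem formInner_barOperator {R : V →ₗ[ℝ] V →ₗ[ℝ] V →ₗ[ℝ] V} {J : V →ₗ[ℝ] V}
    (hR : IsKaehlerCurvature R J) (f h : LinearMap.BilinForm ℝ V) :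
    formInner V (barOperator R f) h = formInner V f (barOperator R h) := by
  simp only [formInner_apply, barOperator_apply, Finset.sum_mul, Finset.mul_sum]
  have e : ∀ F : Fin (finrank ℝ V) → Fin (finrank ℝ V) → Fin (finrank ℝ V) →
      Fin (finrank ℝ V) → ℝ, ∑ i, ∑ j, ∑ k, ∑ l, F i j k l = ∑ i, ∑ j, ∑ k, ∑ l, F k l i j := by
    intro F
    simp only [← Fintype.sum_prod_type']
    exact Fintype.sum_equiv (Equiv.mk (fun p => (p.2.2.1, p.2.2.2, p.1, p.2.1))
      (fun p => (p.2.2.1, p.2.2.2, p.1, p.2.1)) (fun _ => rfl) (fun _ => rfl)) _ _ fun _ => rfl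
  rw [e]
  refine Finset.sum_congr rfl fun i _ => Finset.sum_congr rfl fun j _ =>
    Finset.sum_congr rfl fun k _ => Finset.sum_congr rfl fun l _ => ?_
  rw [hR.antisymm, inner_neg_left, hR.skew, neg_neg]
  ring

theorem formInner_curvatureOperator {R : V →ₗ[ℝ] V →ₗ[ℝ] V →ₗ[ℝ] V} {J : V →ₗ[ℝ] V}
    (hR : IsKaehlerCurvature R J) (f h : tracelessSym V) :
    formInner V (curvatureOperator R f : LinearMap.BilinForm ℝ V) h =
      formInner V (f : LinearMap.BilinForm ℝ V) (curvatureOperator R h) := by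
  rw [curvatureOperator, LinearMap.comp_apply, LinearMap.comp_apply, LinearMap.comp_apply,
    LinearMap.comp_apply, formInner_projTracelessSym, formInner_barOperator hR, formInner_comm,
    formInner_comm (f : LinearMap.BilinForm ℝ V), formInner_projTracelessSym]
  rfl

/-- The curvature operator of the second kind determines the curvature tensor. -/
theorem IsKaehlerCurvature.eq_zero_of_curvatureOperator {R : V →ₗ[ℝ] V →ₗ[ℝ] V →ₗ[ℝ] V}
    {J : V →ₗ[ℝ] V} (hR : IsKaehlerCurvature R J) (h : curvatureOperator R = 0) : R = 0 := by
  refine hR.eq_zero_of_sectional fun x y hxy => ?_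
  -- The test tensor x ⊗ y + y ⊗ x is trace-free because x ⊥ y, and pairing it with its image gives
  -- 2⟨R(x,y)y,x⟩.
  let s : tracelessSym V := ⟨innerTensor x y + innerTensor y x, fun u v => by
      simp only [LinearMap.add_apply, innerTensor_apply]; ring, by
    rw [← formInner_innerₗ, map_add, formInner_innerTensor, formInner_innerTensor]
    simp [hxy, real_inner_comm x y]⟩
  have h0 : formInner V (curvatureOperator R s : LinearMap.BilinForm ℝ V) s = 0 := by
    rw [h]; simp
  rw [curvatureOperator, LinearMap.comp_apply, formInner_projTracelessSym] at h0
  simp only [s, LinearMap.comp_apply, Submodule.subtype_apply, map_add, LinearMap.add_apply,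
    formInner_innerTensor, barOperator_innerTensor, hR.apply_self, inner_zero_left] at h0
  have h1 : inner ℝ (R y x x) y = inner ℝ (R x y y) x := by
    rw [hR.antisymm, inner_neg_left, hR.skew, neg_neg]
  linarith

/-! ### Traces on trace-free symmetric tensors -/

theorem trace_innerTensor (x y : V) : trace V (innerTensor x y) = inner ℝ x y := by
  rw [← formInner_innerₗ, formInner_innerTensor, innerₗ_apply_apply]

theorem trace_barOperator_innerTensor (R : V →ₗ[ℝ] V →ₗ[ℝ] V →ₗ[ℝ] V) (a b : V) :
    trace V (barOperator R (innerTensor a b)) = ∑ k, inner ℝ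
      (R (stdOrthonormalBasis ℝ V k) a (stdOrthonormalBasis ℝ V k)) b := by
  simp only [trace, LinearMap.coe_mk, AddHom.coe_mk, barOperator_innerTensor]

/-- Cyclicity of the trace moves the computation to all bilinear forms, where the basis e_i ⊗ e_j is
available. -/
theorem trace_tracelessSym_comp (F : tracelessSym V →ₗ[ℝ] tracelessSym V)
    (G : LinearMap.BilinForm ℝ V →ₗ[ℝ] LinearMap.BilinForm ℝ V) :
    LinearMap.trace ℝ (tracelessSym V) (F ∘ₗ projTracelessSym V ∘ₗ G ∘ₗ (tracelessSym V).subtype) =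
      LinearMap.trace ℝ _ ((tracelessSym V).subtype ∘ₗ F ∘ₗ projTracelessSym V ∘ₗ G) := by
  have : F ∘ₗ projTracelessSym V ∘ₗ G ∘ₗ (tracelessSym V).subtype =
    (F ∘ₗ projTracelessSym V ∘ₗ G) ∘ₗ (tracelessSym V).subtype := rfl
  rw [this, LinearMap.trace_comp_comm']

theorem trace_tracelessSym (F : tracelessSym V →ₗ[ℝ] tracelessSym V) :
    LinearMap.trace ℝ (tracelessSym V) F =
      LinearMap.trace ℝ _ ((tracelessSym V).subtype ∘ₗ F ∘ₗ projTracelessSym V) := by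
  have := trace_tracelessSym_comp F LinearMap.id
  rwa [LinearMap.id_comp, projTracelessSym_comp_subtype, LinearMap.comp_id, LinearMap.comp_id]
    at this

theorem trace_id_tracelessSym (hn : finrank ℝ V ≠ 0) :
    LinearMap.trace ℝ (tracelessSym V) LinearMap.id =
      ((finrank ℝ V : ℝ) ^ 2 + finrank ℝ V) / 2 - 1 := by
  classical
  have hn' : (finrank ℝ V : ℝ) ≠ 0 := by exact_mod_cast hn
  rw [trace_tracelessSym, trace_bilinForm_eq_sum (stdOrthonormalBasis ℝ V)]
  simp only [LinearMap.comp_apply, LinearMap.id_apply, Submodule.subtype_apply,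
    projTracelessSym_coe, trace_innerTensor, innerTensor_apply,
    orthonormal_iff_ite.1 (stdOrthonormalBasis ℝ V).orthonormal]
  simp [Finset.sum_sub_distrib, ← Finset.mul_sum, Finset.sum_add_distrib, hn']
  ring

/-- The scalar curvature. -/
noncomputable def scalarCurvature (R : V →ₗ[ℝ] V →ₗ[ℝ] V →ₗ[ℝ] V) : ℝ :=
  ∑ i, ∑ j, inner ℝ (R (stdOrthonormalBasis ℝ V j) (stdOrthonormalBasis ℝ V i)
    (stdOrthonormalBasis ℝ V i)) (stdOrthonormalBasis ℝ V j)

namespace IsKaehlerCurvature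

variable {R : V →ₗ[ℝ] V →ₗ[ℝ] V →ₗ[ℝ] V} {J : V →ₗ[ℝ] V}

/-- The action `h ↦ h(J·, J·)` of the complex structure on trace-free symmetric tensors. -/
noncomputable def pullback (hR : IsKaehlerCurvature R J) :
    tracelessSym V →ₗ[ℝ] tracelessSym V where
  toFun h := ⟨LinearMap.BilinForm.comp h J J, fun u v => h.2.1 _ _, by
    have := hR.sum_apply_map_map (stdOrthonormalBasis ℝ V) h
    exact this.trans h.2.2⟩
  map_add' _ _ := rfl
  map_smul' _ _ := rfl

theorem pullback_coe (hR : IsKaehlerCurvature R J) (h : tracelessSym V) (u v : V) :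
    (hR.pullback h : LinearMap.BilinForm ℝ V) u v = (h : LinearMap.BilinForm ℝ V) (J u) (J v) := rfl

theorem formInner_pullback_pullback (hR : IsKaehlerCurvature R J) (h : tracelessSym V) :
    formInner V (hR.pullback h : LinearMap.BilinForm ℝ V) (hR.pullback h) =
      formInner V (h : LinearMap.BilinForm ℝ V) h := by
  simp only [formInner_apply, pullback_coe]
  set e := stdOrthonormalBasis ℝ V
  set f : LinearMap.BilinForm ℝ V := h.1
  have h1 : ∀ i, ∑ j, f (J (e i)) (J (e j)) * f (J (e i)) (J (e j)) =
      ∑ j, f (J (e i)) (e j) * f (J (e i)) (e j) := fun i =>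
    hR.sum_apply_map_map e (LinearMap.BilinForm.linMulLin (f (J (e i))) (f (J (e i))))
  have h2 : ∀ j, ∑ i, f (J (e i)) (e j) * f (J (e i)) (e j) =
      ∑ i, f (e i) (e j) * f (e i) (e j) := fun j =>
    hR.sum_apply_map_map e
      (LinearMap.BilinForm.linMulLin (LinearMap.flip f (e j)) (LinearMap.flip f (e j)))
  rw [Finset.sum_congr rfl fun i _ => h1 i, Finset.sum_comm,
    Finset.sum_congr rfl fun j _ => h2 j, Finset.sum_comm]

/-- Expand |h ± Ph|² ≥ 0 and use |Ph| = |h|. -/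
theorem abs_formInner_pullback_le (hR : IsKaehlerCurvature R J) (h : tracelessSym V) :
    |formInner V (hR.pullback h : LinearMap.BilinForm ℝ V) h| ≤
      formInner V (h : LinearMap.BilinForm ℝ V) h := by
  have h1 := formInner_self_nonneg ((h : LinearMap.BilinForm ℝ V) + (hR.pullback h).1)
  have h2 := formInner_self_nonneg ((h : LinearMap.BilinForm ℝ V) - (hR.pullback h).1)
  have h3 := hR.formInner_pullback_pullback h
  have h4 := formInner_comm (h : LinearMap.BilinForm ℝ V) (hR.pullback h)
  simp only [map_add, map_sub, LinearMap.add_apply, LinearMap.sub_apply] at h1 h2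
  rw [abs_le]
  constructor <;> linarith

theorem trace_pullback (hR : IsKaehlerCurvature R J) (hn : finrank ℝ V ≠ 0) :
    LinearMap.trace ℝ (tracelessSym V) hR.pullback = -(finrank ℝ V : ℝ) / 2 - 1 := by
  classical
  have hn' : (finrank ℝ V : ℝ) ≠ 0 := by exact_mod_cast hn
  rw [trace_tracelessSym, trace_bilinForm_eq_sum (stdOrthonormalBasis ℝ V)]
  simp only [LinearMap.comp_apply, Submodule.subtype_apply, pullback_coe,
    projTracelessSym_coe, trace_innerTensor, innerTensor_apply, hR.inner_self, hR.inner_map,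
    orthonormal_iff_ite.1 (stdOrthonormalBasis ℝ V).orthonormal]
  have h1 : ∀ i, ∑ j, inner ℝ (stdOrthonormalBasis ℝ V i) (J (stdOrthonormalBasis ℝ V j)) *
      inner ℝ (stdOrthonormalBasis ℝ V j) (J (stdOrthonormalBasis ℝ V i)) = -1 := fun i => by
    have h2 := (stdOrthonormalBasis ℝ V).sum_inner_mul_inner (J (stdOrthonormalBasis ℝ V i))
      (J (stdOrthonormalBasis ℝ V i))
    rw [hR.inner_map, orthonormal_iff_ite.1 (stdOrthonormalBasis ℝ V).orthonormal,
      if_pos rfl] at h2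
    rw [← h2, ← Finset.sum_neg_distrib]
    refine Finset.sum_congr rfl fun j _ => ?_
    rw [hR.inner_left]
    ring
  simp [Finset.sum_sub_distrib, ← Finset.mul_sum, h1, hn']
  ring

theorem sum_inner_swap (hR : IsKaehlerCurvature R J) :
    ∑ i, ∑ j, inner ℝ (R (stdOrthonormalBasis ℝ V j) (stdOrthonormalBasis ℝ V i)
      (stdOrthonormalBasis ℝ V j)) (stdOrthonormalBasis ℝ V i) = -scalarCurvature R := by
  simp only [scalarCurvature, ← Finset.sum_neg_distrib]
  exact Finset.sum_congr rfl fun i _ => Finset.sum_congr rfl fun j _ => hR.skew _ _ _ _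

theorem trace_curvatureOperator (hR : IsKaehlerCurvature R J) :
    LinearMap.trace ℝ (tracelessSym V) (curvatureOperator R) =
      scalarCurvature R / 2 + scalarCurvature R / finrank ℝ V := by
  classical
  rw [curvatureOperator, ← LinearMap.id_comp (projTracelessSym V ∘ₗ _), trace_tracelessSym_comp,
    trace_bilinForm_eq_sum (stdOrthonormalBasis ℝ V)]
  simp only [LinearMap.comp_apply, LinearMap.id_apply, Submodule.subtype_apply,
    projTracelessSym_coe, barOperator_innerTensor, trace_barOperator_innerTensor,
    orthonormal_iff_ite.1 (stdOrthonormalBasis ℝ V).orthonormal, hR.apply_self, inner_zero_left]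
  simp only [Finset.sum_sub_distrib, ← Finset.mul_sum, zero_add, mul_ite, mul_one, mul_zero,
    Finset.sum_ite_eq, Finset.mem_univ, if_true, ← Finset.sum_div]
  rw [hR.sum_inner_swap, scalarCurvature]
  ring

/-- Symmetrization yields half the sum of two contractions with J, equal to −2s (`h5`) and −s
(`h2`); removing the trace adds s/n, where n = dim V. This is where R commuting with J enters the
traces. -/
theorem trace_pullback_comp_curvatureOperator (hR : IsKaehlerCurvature R J) :
    LinearMap.trace ℝ (tracelessSym V) (hR.pullback ∘ₗ curvatureOperator R) =
      -3 / 2 * scalarCurvature R + scalarCurvature R / finrank ℝ V := by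
  classical
  rw [curvatureOperator, trace_tracelessSym_comp,
    trace_bilinForm_eq_sum (stdOrthonormalBasis ℝ V)]
  simp only [LinearMap.comp_apply, Submodule.subtype_apply, pullback_coe,
    projTracelessSym_coe, barOperator_innerTensor, trace_barOperator_innerTensor,
    hR.inner_map, orthonormal_iff_ite.1 (stdOrthonormalBasis ℝ V).orthonormal]
  simp only [Finset.sum_sub_distrib, ← Finset.mul_sum, mul_ite, mul_one, mul_zero,
    Finset.sum_ite_eq, Finset.mem_univ, if_true, ← Finset.sum_div, Finset.sum_add_distrib]
  set e := stdOrthonormalBasis ℝ V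
  set s := scalarCurvature R with hs
  rw [hR.sum_inner_swap, ← hs]
  have hxy : ∀ a : V, ∑ j, inner ℝ (R (J (e j)) a a) (J (e j)) = ∑ j, inner ℝ (R (e j) a a) (e j) :=
    fun a => hR.sum_apply_map_map e (LinearMap.mk₂ ℝ (fun k l => inner ℝ (R k a a) l)
      (by simp [inner_add_left]) (by simp [inner_smul_left]) (by simp [inner_add_right])
      (by simp [inner_smul_right]))
  have h2 : ∑ i, ∑ j, inner ℝ (R (J (e j)) (e i) (J (e i))) (e j) = -s := by
    rw [hs, scalarCurvature, ← Finset.sum_neg_distrib]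
    refine Finset.sum_congr rfl fun i _ => ?_
    rw [← hxy, ← Finset.sum_neg_distrib]
    refine Finset.sum_congr rfl fun j _ => ?_
    rw [hR.comm, hR.inner_left]
  have h3 : ∑ i, ∑ j, inner ℝ (R (J (e j)) (J (e i)) (e i)) (e j) = s := by
    have h4 : ∑ i, ∑ j, inner ℝ (R (J (e j)) (J (e i)) (e i)) (e j) =
        ∑ i, ∑ j, inner ℝ (R (e j) (J (e i)) (J (e i))) (e j) := by
      refine Finset.sum_congr rfl fun i _ => ?_
      rw [← hxy]
      exact Finset.sum_congr rfl fun j _ => by rw [hR.comm, hR.inner_map]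
    rw [h4, hs, scalarCurvature]
    refine Finset.sum_comm.trans (Eq.trans (Finset.sum_congr rfl fun j _ => ?_) Finset.sum_comm)
    exact hR.sum_apply_map_map e (LinearMap.mk₂ ℝ (fun k l => inner ℝ (R (e j) k l) (e j))
      (by simp [inner_add_left]) (by simp [inner_smul_left]) (by simp [inner_add_left])
      (by simp [inner_smul_left]))
  -- Bianchi for (Je_i, e_i, Je_j) reduces this contraction to the previous two.
  have h5 : ∑ i, ∑ j, inner ℝ (R (J (e i)) (e i) (J (e j))) (e j) = -s - s := by
    refine Eq.trans ?_ (congrArg₂ (· - ·) h2 h3)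
    simp only [← Finset.sum_sub_distrib]
    refine Finset.sum_congr rfl fun i _ => Finset.sum_congr rfl fun j _ => ?_
    have hb := congrArg (fun z => inner ℝ z (e j)) (hR.bianchi (J (e i)) (e i) (J (e j)))
    simp only [inner_add_left, inner_zero_left] at hb
    rw [hR.antisymm (e i) (J (e j)) (J (e i)), inner_neg_left] at hb
    linarith
  rw [h5, h2]
  ring

end IsKaehlerCurvature

/-! ### The pointwise vanishing theorem -/

/-- A Kähler curvature tensor in real dimension `2m` whose curvature operator of the second kind is
`k`-nonnegative or `k`-nonpositive for some `k < 3 (m² - 1) / 2` vanishes. -/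
theorem IsKaehlerCurvature.eq_zero {R : V →ₗ[ℝ] V →ₗ[ℝ] V →ₗ[ℝ] V} {J : V →ₗ[ℝ] V}
    (hR : IsKaehlerCurvature R J) {m : ℕ} (hm : 2 ≤ m) (hV : finrank ℝ V = 2 * m)
    {k : ℝ} (hk : 0 < k) (hkm : k < 3 / 2 * ((m : ℝ) ^ 2 - 1))
    (h : IsKNonnegCurvature k R ∨ IsKNonposCurvature k R) : R = 0 := by
  have hm' : (2 : ℝ) ≤ m := by exact_mod_cast hm
  have hm0 : (m : ℝ) ≠ 0 := by positivity
  have hn : finrank ℝ V ≠ 0 := by omega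
  have hnr : (finrank ℝ V : ℝ) = 2 * m := by rw [hV]; push_cast; ring
  let B : LinearMap.BilinForm ℝ (tracelessSym V) :=
    LinearMap.BilinForm.comp (formInner V) (tracelessSym V).subtype (tracelessSym V).subtype
  -- The solution of c + d = 1 and c(m+1) = d(3m−1): the first makes the top eigenvalue of `A` equal
  -- 1, the second makes tr(AT) vanish. Positivity of `A` is d < c, which needs m > 1.
  set c : ℝ := (3 * m - 1) / (4 * m) with hc
  set d : ℝ := (m + 1) / (4 * m) with hd
  have hcd : c + d = 1 := by rw [hc, hd]; field_simp; ring
  have hd0 : 0 < d := by rw [hd]; positivity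
  have hcd' : d < c := by
    rw [hc, hd]
    exact div_lt_div_of_pos_right (by linarith) (by positivity)
  let A : tracelessSym V →ₗ[ℝ] tracelessSym V := c • LinearMap.id + d • hR.pullback
  have hA : ∀ v, B (A v) v = c * B v v + d * B (hR.pullback v) v := fun v => by simp [A]
  have habs : ∀ v, |B (hR.pullback v) v| ≤ B v v := hR.abs_formInner_pullback_le
  have hpos : ∀ v, v ≠ 0 → 0 < B v v := fun v hv =>
    formInner_self_pos fun h0 => hv (Subtype.ext h0)
  have hA0 : ∀ v, v ≠ 0 → 0 < B (A v) v := fun v hv => by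
    have h1 := (abs_le.1 (habs v)).1
    rw [hA]
    nlinarith [hpos v hv]
  have hA1 : ∀ v, B (A v) v ≤ B v v := fun v => by
    have h1 := (abs_le.1 (habs v)).2
    rw [hA]
    have h2 : c * B v v + d * B v v = B v v := by rw [← add_mul, hcd, one_mul]
    nlinarith
  have hAtr : k < LinearMap.trace ℝ (tracelessSym V) A := by
    refine hkm.trans_eq ?_
    simp only [A, map_add, map_smul, trace_id_tracelessSym hn, hR.trace_pullback hn, hnr,
      smul_eq_mul, hc, hd]
    field_simp
    ring
  have hATtr : LinearMap.trace ℝ (tracelessSym V) (A ∘ₗ curvatureOperator R) = 0 := by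
    simp only [A, LinearMap.add_comp, LinearMap.smul_comp, LinearMap.id_comp, map_add, map_smul,
      hR.trace_curvatureOperator, hR.trace_pullback_comp_curvatureOperator, hnr,
      smul_eq_mul, hc, hd]
    field_simp
    ring
  have hT : ∀ u v, B (curvatureOperator R u) v = B u (curvatureOperator R v) :=
    formInner_curvatureOperator hR
  have hBs : ∀ u v, B u v = B v u := fun u v => formInner_comm _ _
  apply hR.eq_zero_of_curvatureOperator
  rcases h with h | h
  · exact IsKNonneg.eq_zero B hBs hpos hT hA0 hA1 hk hAtr hATtr h
  · exact IsKNonpos.eq_zero B hBs hpos hT hA0 hA1 hk hAtr hATtr h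

end SecondKind

/-! ### Levi-Civita connection and curvature in coordinates -/

namespace LocalGeometry

variable {E : Type*} [NormedAddCommGroup E] [NormedSpace ℝ E]

/-- `G` is a smooth Riemannian metric on the open set `U`. -/
structure IsMetricOn (G : E → E →L[ℝ] E →L[ℝ] ℝ) (U : Set E) : Prop where
  isOpen : IsOpen U
  contDiffOn : ContDiffOn ℝ ∞ G U
  symm : ∀ y ∈ U, ∀ u v, G y u v = G y v u
  pos : ∀ y ∈ U, ∀ u, u ≠ 0 → 0 < G y u u

/-- `(G, J)` is a Kähler structure on the open set `U`. -/
structure IsKaehlerOn (G : E → E →L[ℝ] E →L[ℝ] ℝ) (J : E → E →L[ℝ] E) (U : Set E) : Prop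
    extends IsMetricOn G U where
  contDiffOn_endo : ContDiffOn ℝ ∞ J U
  sq : ∀ y ∈ U, ∀ u, J y (J y u) = -u
  orthogonal : ∀ y ∈ U, ∀ u v, G y (J y u) (J y v) = G y u v
  integrable : ∀ y ∈ U, ∀ u v, nijenhuis J y u v = 0
  closed : ∀ y ∈ U, ∀ u v w, extDerivTwoForm (fundamentalForm G J) y u v w = 0

section Calculus

variable {F F' : Type*} [NormedAddCommGroup F] [NormedSpace ℝ F] [NormedAddCommGroup F']
  [NormedSpace ℝ F']

theorem fderiv_apply_eq {f : E → F →L[ℝ] F'} {x : E} (hf : DifferentiableAt ℝ f x) (u : F)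
    (z : E) : fderiv ℝ (fun y => f y u) x z = fderiv ℝ f x z u := by
  rw [fderiv_clm_apply hf (differentiableAt_const u)]
  simp

theorem fderiv_apply_apply_eq {f : E → F →L[ℝ] F'} {g : E → F} {x : E}
    (hf : DifferentiableAt ℝ f x) (hg : DifferentiableAt ℝ g x) (z : E) :
    fderiv ℝ (fun y => f y (g y)) x z = fderiv ℝ f x z (g x) + f x (fderiv ℝ g x z) := by
  rw [fderiv_clm_apply hf hg]
  simp [add_comm]

theorem differentiableAt_apply {f : E → F →L[ℝ] F'} {x : E} (hf : DifferentiableAt ℝ f x) (u : F) :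
    DifferentiableAt ℝ (fun y => f y u) x :=
  hf.clm_apply (differentiableAt_const u)

end Calculus

theorem riemann_antisymm (G : E → E →L[ℝ] E →L[ℝ] ℝ) (y u v w : E) :
    riemann G y u v w = -riemann G y v u w := by
  simp only [riemann_apply]
  abel

namespace IsMetricOn

variable {G : E → E →L[ℝ] E →L[ℝ] ℝ} {U : Set E}

theorem contDiffAt (h : IsMetricOn G U) {y : E} (hy : y ∈ U) : ContDiffAt ℝ ∞ G y :=
  h.contDiffOn.contDiffAt (h.isOpen.mem_nhds hy)

theorem differentiableAt (h : IsMetricOn G U) {y : E} (hy : y ∈ U) : DifferentiableAt ℝ G y :=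
  (h.contDiffAt hy).differentiableAt (by simp)

theorem eq_of_apply_eq (h : IsMetricOn G U) {y : E} (hy : y ∈ U) {a b : E}
    (hab : ∀ w, G y a w = G y b w) : a = b := by
  by_contra hne
  have := h.pos y hy (a - b) (sub_ne_zero.2 hne)
  simp [hab] at this

theorem fderiv_symm (h : IsMetricOn G U) {y : E} (hy : y ∈ U) (z u v : E) :
    fderiv ℝ G y z u v = fderiv ℝ G y z v u := by
  have hd := h.differentiableAt hy
  have e : (fun y => G y u v) =ᶠ[nhds y] fun y => G y v u := by
    filter_upwards [h.isOpen.mem_nhds hy] with y' hy' using h.symm y' hy' u v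
  have := DFunLike.congr_fun (e.fderiv_eq (𝕜 := ℝ)) z
  simpa only [fderiv_apply_eq (differentiableAt_apply hd _), fderiv_apply_eq hd] using this

variable [FiniteDimensional ℝ E]

/-- Positivity gives injectivity, hence invertibility in finite dimension. Thus `inverse` in
`christoffel` is a genuine inverse and not its default value 0. -/
theorem exists_equiv (h : IsMetricOn G U) {y : E} (hy : y ∈ U) :
    ∃ e : E ≃L[ℝ] (E →L[ℝ] ℝ), (e : E →L[ℝ] E →L[ℝ] ℝ) = G y := by
  have hinj : Function.Injective (G y) := fun a b hab =>
    h.eq_of_apply_eq hy fun w => by rw [hab]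
  have hfr : finrank ℝ E = finrank ℝ (E →L[ℝ] ℝ) := by
    rw [← (LinearMap.toContinuousLinearMap (𝕜 := ℝ) (E := E) (F' := ℝ)).finrank_eq]
    exact Subspace.dual_finrank_eq.symm
  refine ⟨(LinearEquiv.ofInjectiveOfFinrankEq (G y : E →ₗ[ℝ] E →L[ℝ] ℝ) hinj
    hfr).toContinuousLinearEquiv, ?_⟩
  ext u v
  rfl

theorem apply_christoffel (h : IsMetricOn G U) {y : E} (hy : y ∈ U) (u v w : E) :
    G y (christoffel G y u v) w = christoffelFirst G y u v w := by
  obtain ⟨e, he⟩ := h.exists_equiv hy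
  rw [christoffel_apply, ← he, ContinuousLinearMap.inverse_equiv]
  simp

theorem contDiffOn_christoffelFirst (h : IsMetricOn G U) :
    ContDiffOn ℝ ∞ (christoffelFirst G) U := by
  have hd : ContDiffOn ℝ ∞ (fderiv ℝ G) U := h.contDiffOn.fderiv_of_isOpen h.isOpen (by simp)
  have hd' : ∀ u v w, ContDiffOn ℝ ∞ (fun y => fderiv ℝ G y u v w) U := fun u v w =>
    ((hd.clm_apply contDiffOn_const).clm_apply contDiffOn_const).clm_apply contDiffOn_const
  refine contDiffOn_clm_apply.2 fun u => contDiffOn_clm_apply.2 fun v =>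
    contDiffOn_clm_apply.2 fun w => ?_
  simp only [christoffelFirst_apply]
  exact contDiffOn_const.mul (((hd' u v w).add (hd' v u w)).sub (hd' w u v))

theorem contDiffOn_christoffel (h : IsMetricOn G U) : ContDiffOn ℝ ∞ (christoffel G) U := by
  refine contDiffOn_clm_apply.2 fun u => contDiffOn_clm_apply.2 fun v => ?_
  simp only [christoffel_apply]
  have hinv : ContDiffOn ℝ ∞ (fun y => (G y).inverse) U := fun y hy => by
    obtain ⟨e, he⟩ := h.exists_equiv hy
    have hi : ContDiffAt ℝ ∞ ContinuousLinearMap.inverse (G y) := by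
      rw [← he]; exact contDiffAt_map_inverse e
    exact (hi.comp y (h.contDiffAt hy)).contDiffWithinAt
  exact hinv.clm_apply ((h.contDiffOn_christoffelFirst.clm_apply contDiffOn_const).clm_apply
    contDiffOn_const)

theorem differentiableAt_christoffel (h : IsMetricOn G U) {y : E} (hy : y ∈ U) :
    DifferentiableAt ℝ (christoffel G) y :=
  (h.contDiffOn_christoffel.contDiffAt (h.isOpen.mem_nhds hy)).differentiableAt (by simp)

theorem christoffel_symm (h : IsMetricOn G U) {y : E} (hy : y ∈ U) (u v : E) :
    christoffel G y u v = christoffel G y v u := by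
  refine h.eq_of_apply_eq hy fun w => ?_
  rw [h.apply_christoffel hy, h.apply_christoffel hy, christoffelFirst_apply,
    christoffelFirst_apply, h.fderiv_symm hy w u v]
  ring

/-- The Levi-Civita connection preserves the metric. -/
theorem fderiv_apply (h : IsMetricOn G U) {y : E} (hy : y ∈ U) (u v w : E) :
    fderiv ℝ G y u v w = G y (christoffel G y u v) w + G y v (christoffel G y u w) := by
  rw [h.symm y hy v, h.apply_christoffel hy, h.apply_christoffel hy, christoffelFirst_apply,
    christoffelFirst_apply, h.fderiv_symm hy u w v, h.fderiv_symm hy w u v]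
  ring

theorem fderiv_christoffel_symm (h : IsMetricOn G U) {y : E} (hy : y ∈ U) (z u v : E) :
    fderiv ℝ (christoffel G) y z u v = fderiv ℝ (christoffel G) y z v u := by
  have hd := h.differentiableAt_christoffel hy
  have e : (fun y => christoffel G y u v) =ᶠ[nhds y] fun y => christoffel G y v u := by
    filter_upwards [h.isOpen.mem_nhds hy] with y' hy' using h.christoffel_symm hy' u v
  have := DFunLike.congr_fun (e.fderiv_eq (𝕜 := ℝ)) z
  simpa only [fderiv_apply_eq (differentiableAt_apply hd _), fderiv_apply_eq hd] using this

theorem riemann_bianchi (h : IsMetricOn G U) {y : E} (hy : y ∈ U) (u v w : E) :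
    riemann G y u v w + riemann G y v w u + riemann G y w u v = 0 := by
  simp only [riemann_apply]
  rw [h.fderiv_christoffel_symm hy u w v, h.fderiv_christoffel_symm hy v u w,
    h.fderiv_christoffel_symm hy w v u, h.christoffel_symm hy w v, h.christoffel_symm hy u w,
    h.christoffel_symm hy v u]
  abel

/-- Differentiate ∇G = 0 once more and antisymmetrize: the second derivatives of G cancel and only
curvature remains. -/
theorem riemann_skew (h : IsMetricOn G U) {y : E} (hy : y ∈ U) (u v w z : E) :
    G y (riemann G y u v w) z = -G y (riemann G y u v z) w := by
  have hG := h.differentiableAt hy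
  have hΓ := h.differentiableAt_christoffel hy
  have hG2 : DifferentiableAt ℝ (fderiv ℝ G) y :=
    ((h.contDiffOn.fderiv_of_isOpen h.isOpen (m := ∞) (by simp)).contDiffAt
      (h.isOpen.mem_nhds hy)).differentiableAt (by simp)
  have key : ∀ a b, fderiv ℝ (fderiv ℝ G) y a b w z =
      fderiv ℝ G y a (christoffel G y b w) z + G y (fderiv ℝ (christoffel G) y a b w) z +
        (fderiv ℝ G y a w (christoffel G y b z) + G y w (fderiv ℝ (christoffel G) y a b z)) := by
    intro a b
    have e : (fun y => fderiv ℝ G y b w z) =ᶠ[nhds y]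
        fun y => G y (christoffel G y b w) z + G y w (christoffel G y b z) := by
      filter_upwards [h.isOpen.mem_nhds hy] with y' hy' using h.fderiv_apply hy' b w z
    have hw := differentiableAt_apply (differentiableAt_apply hΓ b) w
    have hz := differentiableAt_apply (differentiableAt_apply hΓ b) z
    have h1 := DFunLike.congr_fun (e.fderiv_eq (𝕜 := ℝ)) a
    rw [fderiv_apply_eq (differentiableAt_apply (differentiableAt_apply hG2 _) _),
      fderiv_apply_eq (differentiableAt_apply hG2 _), fderiv_apply_eq hG2,
      fderiv_fun_add (differentiableAt_apply (hG.clm_apply hw) _)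
        ((differentiableAt_apply hG _).clm_apply hz), add_apply,
      fderiv_apply_eq (hG.clm_apply hw), fderiv_apply_apply_eq hG hw,
      fderiv_apply_apply_eq (differentiableAt_apply hG _) hz, fderiv_apply_eq hG,
      fderiv_apply_eq (differentiableAt_apply hΓ _), fderiv_apply_eq hΓ,
      fderiv_apply_eq (differentiableAt_apply hΓ _), fderiv_apply_eq hΓ] at h1
    simpa using h1
  have hs : fderiv ℝ (fderiv ℝ G) y u v = fderiv ℝ (fderiv ℝ G) y v u :=
    ((h.contDiffAt hy).isSymmSndFDerivAt (by simpa using ENat.LEInfty.out)) u v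
  have k1 := key u v
  have k2 := key v u
  rw [hs, k2] at k1
  simp only [h.fderiv_apply hy] at k1
  simp only [riemann_apply, map_add, map_sub, add_apply,
    sub_apply]
  rw [h.symm y hy (fderiv ℝ (christoffel G) y u v z) w,
    h.symm y hy (fderiv ℝ (christoffel G) y v u z) w,
    h.symm y hy (christoffel G y u (christoffel G y v z)) w,
    h.symm y hy (christoffel G y v (christoffel G y u z)) w]
  linarith

end IsMetricOn

/-! ### The complex structure is parallel -/

namespace IsKaehlerOn

variable {G : E → E →L[ℝ] E →L[ℝ] ℝ} {J : E → E →L[ℝ] E} {U : Set E}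

theorem differentiableAt_endo (h : IsKaehlerOn G J U) {y : E} (hy : y ∈ U) :
    DifferentiableAt ℝ J y :=
  (h.contDiffOn_endo.contDiffAt (h.isOpen.mem_nhds hy)).differentiableAt (by simp)

theorem apply_endo_left (h : IsKaehlerOn G J U) {y : E} (hy : y ∈ U) (u v : E) :
    G y (J y u) v = -G y u (J y v) := by
  rw [← h.orthogonal y hy u (J y v), h.sq y hy, map_neg, neg_neg]

theorem fderiv_endo_endo (h : IsKaehlerOn G J U) {y : E} (hy : y ∈ U) (u v : E) :
    fderiv ℝ J y u (J y v) + J y (fderiv ℝ J y u v) = 0 := by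
  have hJ := h.differentiableAt_endo hy
  have e : (fun y => J y (J y v)) =ᶠ[nhds y] fun _ => -v := by
    filter_upwards [h.isOpen.mem_nhds hy] with y' hy' using h.sq y' hy' v
  have := DFunLike.congr_fun (e.fderiv_eq (𝕜 := ℝ)) u
  simpa [fderiv_apply_apply_eq hJ (differentiableAt_apply hJ v), fderiv_apply_eq hJ] using this

theorem fderiv_metric_endo (h : IsKaehlerOn G J U) {y : E} (hy : y ∈ U) (u v w : E) :
    fderiv ℝ G y u (J y v) w + G y (fderiv ℝ J y u v) w +
      (fderiv ℝ G y u v (J y w) + G y v (fderiv ℝ J y u w)) = 0 := by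
  have hJ := h.differentiableAt_endo hy
  have hG := h.toIsMetricOn.differentiableAt hy
  have e : (fun y => G y (J y v) w + G y v (J y w)) =ᶠ[nhds y] fun _ => (0 : ℝ) := by
    filter_upwards [h.isOpen.mem_nhds hy] with y' hy'
    rw [h.apply_endo_left hy']; ring
  have h1 := DFunLike.congr_fun (e.fderiv_eq (𝕜 := ℝ)) u
  have hv := differentiableAt_apply hJ v
  have hw := differentiableAt_apply hJ w
  rw [fderiv_fun_add (differentiableAt_apply (hG.clm_apply hv) _)
        ((differentiableAt_apply hG _).clm_apply hw), add_apply,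
      fderiv_apply_eq (hG.clm_apply hv), fderiv_apply_apply_eq hG hv,
      fderiv_apply_apply_eq (differentiableAt_apply hG _) hw, fderiv_apply_eq hG,
      fderiv_apply_eq hJ, fderiv_apply_eq hJ] at h1
  simpa using h1

theorem fderiv_fundamentalForm (h : IsKaehlerOn G J U) {y : E} (hy : y ∈ U) (u v w : E) :
    fderiv ℝ (fundamentalForm G J) y u v w =
      fderiv ℝ G y u (J y v) w + G y (fderiv ℝ J y u v) w := by
  have hJ := h.differentiableAt_endo hy
  have hG := h.toIsMetricOn.differentiableAt hy
  have hω : DifferentiableAt ℝ (fundamentalForm G J) y := hG.clm_comp hJ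
  have hv := differentiableAt_apply hJ v
  rw [← fderiv_apply_eq hω, ← fderiv_apply_eq (differentiableAt_apply hω v)]
  change fderiv ℝ (fun y => G y (J y v) w) y u = _
  rw [fderiv_apply_eq (hG.clm_apply hv), fderiv_apply_apply_eq hG hv, fderiv_apply_eq hJ]
  simp

variable [FiniteDimensional ℝ E]

/-- The complex structure of a Kähler metric is parallel. -/
theorem fderiv_endo (h : IsKaehlerOn G J U) {y : E} (hy : y ∈ U) (u v : E) :
    fderiv ℝ J y u v = J y (christoffel G y u v) - christoffel G y u (J y v) := by
  have hM := h.toIsMetricOn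
  -- P(u,v) = (∇_u J)v, and S is its lowered form. The four facts below express orthogonality of J,
  -- J² = −1, dω = 0 and integrability in terms of S.
  set P : E → E → E := fun u v =>
    fderiv ℝ J y u v + christoffel G y u (J y v) - J y (christoffel G y u v) with hP
  set S : E → E → E → ℝ := fun u v w => G y (P u v) w with hS
  have hDJ : ∀ u v, fderiv ℝ J y u v = P u v - christoffel G y u (J y v) +
      J y (christoffel G y u v) := fun u v => by simp only [hP]; abel
  have hskew : ∀ u v w, S u v w = -S u w v := fun u v w => by
    have h1 := h.fderiv_metric_endo hy u v w
    rw [hM.fderiv_apply hy, hM.fderiv_apply hy, hDJ, hDJ, hM.symm y hy v (_ + _)] at h1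
    simp only [map_add, map_sub, add_apply, sub_apply] at h1
    have h2 := hM.symm y hy (J y v) (christoffel G y u w)
    have h3 := hM.symm y hy v (christoffel G y u (J y w))
    have h4 := h.apply_endo_left hy (christoffel G y u v) w
    have h5 := h.apply_endo_left hy (christoffel G y u w) v
    simp only [hS]
    linarith
  have hJ2 : ∀ u v w, S u (J y v) w = S u v (J y w) := fun u v w => by
    have h1 := h.fderiv_endo_endo hy u v
    have h2 : P u (J y v) = -J y (P u v) := by
      simp only [hP, h.sq y hy, map_add, map_sub, map_neg]
      rw [eq_neg_of_add_eq_zero_left h1]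
      abel
    simp only [hS]
    rw [h2, map_neg, neg_apply, h.apply_endo_left hy, neg_neg]
  have hcyc : ∀ u v w, S u v w + S v w u + S w u v = 0 := fun u v w => by
    have h1 := h.closed y hy u v w
    simp only [extDerivTwoForm, h.fderiv_fundamentalForm hy, hM.fderiv_apply hy, hDJ, map_add,
      map_sub, add_apply, sub_apply,
      h.apply_endo_left hy] at h1
    rw [hM.christoffel_symm hy v u, hM.christoffel_symm hy w v, hM.christoffel_symm hy w u,
      hM.symm y hy v (J y _), hM.symm y hy w (J y _), hM.symm y hy u (J y _)] at h1
    simp only [h.apply_endo_left hy] at h1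
    simp only [hS]
    linarith
  have hnij : ∀ u v w, S (J y u) v w - S (J y v) u w - S v u (J y w) + S u v (J y w) = 0 :=
    fun u v w => by
      have h1 := h.integrable y hy u v
      have h2 : P (J y u) v - P (J y v) u + J y (P v u) - J y (P u v) = 0 := by
        rw [← h1]
        simp only [nijenhuis, hDJ, map_add, map_sub]
        rw [hM.christoffel_symm hy (J y v) (J y u), hM.christoffel_symm hy v (J y u),
          hM.christoffel_symm hy (J y v) u, hM.christoffel_symm hy v u]
        abel
      have h3 := congrArg (fun z => G y z w) h2
      simp only [map_add, map_sub, add_apply, sub_apply,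
        h.apply_endo_left hy, map_zero, zero_apply] at h3
      simp only [hS]
      linarith
  have hzero : ∀ u v w, S u v w = 0 := fun u v w => by
    -- Since S(u,Jv,Jw) = −S(u,v,w), subtracting the cyclic identity at (u,Jv,Jw) from that at
    -- (u,v,w) leaves 2S(u,v,w) plus terms that cancel by the Nijenhuis identity for (v,w), paired
    -- with Ju.
    have h1 := hcyc u v w
    have h2 := hcyc u (J y v) (J y w)
    have h3 := hnij v w (J y u)
    have h4 : S u (J y v) (J y w) = -S u v w := by
      rw [hJ2, h.sq y hy]; simp [hS]
    have h5 : S w v (J y (J y u)) = -S w v u := by rw [h.sq y hy]; simp [hS]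
    have h6 : S v w (J y (J y u)) = -S v w u := by rw [h.sq y hy]; simp [hS]
    have h7 := hskew w v u
    have h8 := hskew (J y w) (J y v) u
    have h9 := hJ2 (J y v) w u
    have h10 := hskew (J y w) u (J y v)
    have h11 := hJ2 (J y w) v u
    have h12 := hskew w u v
    linarith
  have hPz : P u v = 0 := hM.eq_of_apply_eq hy fun w => by
    rw [map_zero, zero_apply]; exact hzero u v w
  rw [hDJ, hPz]
  abel

/-- Differentiate ∇J = 0 and antisymmetrize; symmetry of the second derivative of J leaves [R(u,v),
J] = 0. -/
theorem riemann_endo (h : IsKaehlerOn G J U) {y : E} (hy : y ∈ U) (u v w : E) :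
    riemann G y u v (J y w) = J y (riemann G y u v w) := by
  have hM := h.toIsMetricOn
  have hJ := h.differentiableAt_endo hy
  have hΓ := hM.differentiableAt_christoffel hy
  have hJ2 : DifferentiableAt ℝ (fderiv ℝ J) y :=
    ((h.contDiffOn_endo.fderiv_of_isOpen h.isOpen (m := ∞) (by simp)).contDiffAt
      (h.isOpen.mem_nhds hy)).differentiableAt (by simp)
  have key : ∀ a b, fderiv ℝ (fderiv ℝ J) y a b w =
      fderiv ℝ J y a (christoffel G y b w) + J y (fderiv ℝ (christoffel G) y a b w) -
        (fderiv ℝ (christoffel G) y a b (J y w) + christoffel G y b (fderiv ℝ J y a w)) := by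
    intro a b
    have e : (fun y => fderiv ℝ J y b w) =ᶠ[nhds y]
        fun y => J y (christoffel G y b w) - christoffel G y b (J y w) := by
      filter_upwards [h.isOpen.mem_nhds hy] with y' hy' using h.fderiv_endo hy' b w
    have hΓb := differentiableAt_apply hΓ b
    have hΓw := differentiableAt_apply hΓb w
    have hJw := differentiableAt_apply hJ w
    have h1 := DFunLike.congr_fun (e.fderiv_eq (𝕜 := ℝ)) a
    rw [fderiv_apply_eq (differentiableAt_apply hJ2 _), fderiv_apply_eq hJ2,
      fderiv_fun_sub (hJ.clm_apply hΓw) (hΓb.clm_apply hJw), sub_apply,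
      fderiv_apply_apply_eq hJ hΓw, fderiv_apply_apply_eq hΓb hJw, fderiv_apply_eq hΓb,
      fderiv_apply_eq hΓ, fderiv_apply_eq hJ] at h1
    exact h1
  have hs : fderiv ℝ (fderiv ℝ J) y u v = fderiv ℝ (fderiv ℝ J) y v u :=
    ((h.contDiffOn_endo.contDiffAt (h.isOpen.mem_nhds hy)).isSymmSndFDerivAt (by simpa using ENat.LEInfty.out)) u v
  have k1 := key u v
  rw [hs, key v u] at k1
  simp only [h.fderiv_endo hy, map_sub] at k1
  simp only [riemann_apply, map_add, map_sub]
  rw [← sub_eq_zero] at k1 ⊢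
  rw [← k1]
  abel

end IsKaehlerOn

end LocalGeometry

/-! ### Kähler structures read in charts -/

namespace RiemannianGeometry

variable {E : Type*} [NormedAddCommGroup E] [NormedSpace ℝ E]
  {M : Type*} [TopologicalSpace M] [ChartedSpace E M]

theorem chartEndo_apply
    (J : (x : M) → TangentSpace 𝓘(ℝ, E) x →L[ℝ] TangentSpace 𝓘(ℝ, E) x) (x₀ : M) (y u : E) :
    chartEndo J x₀ y u =
      mfderiv 𝓘(ℝ, E) 𝓘(ℝ, E) (extChartAt 𝓘(ℝ, E) x₀) ((extChartAt 𝓘(ℝ, E) x₀).symm y)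
        (J _ (mfderiv 𝓘(ℝ, E) 𝓘(ℝ, E) (extChartAt 𝓘(ℝ, E) x₀).symm y u)) := rfl

theorem chartMetric_apply [RiemannianBundle (fun x : M => TangentSpace 𝓘(ℝ, E) x)]
    (x₀ : M) (y u v : E) :
    chartMetric x₀ y u v =
      inner ℝ (E := TangentSpace 𝓘(ℝ, E) ((extChartAt 𝓘(ℝ, E) x₀).symm y))
        (mfderiv 𝓘(ℝ, E) 𝓘(ℝ, E) (extChartAt 𝓘(ℝ, E) x₀).symm y u)
        (mfderiv 𝓘(ℝ, E) 𝓘(ℝ, E) (extChartAt 𝓘(ℝ, E) x₀).symm y v) := rfl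

variable [IsManifold 𝓘(ℝ, E) ∞ M]

/-- This is the tangent map of the smooth inverse chart composed with a constant vector field. -/
theorem contMDiffOn_mfderiv_extChartAt_symm (x₀ : M) (u : E) :
    ContMDiffOn 𝓘(ℝ, E) 𝓘(ℝ, E).tangent ∞
      (fun y => (⟨(extChartAt 𝓘(ℝ, E) x₀).symm y,
        mfderiv 𝓘(ℝ, E) 𝓘(ℝ, E) (extChartAt 𝓘(ℝ, E) x₀).symm y u⟩ : TangentBundle 𝓘(ℝ, E) M))
      (extChartAt 𝓘(ℝ, E) x₀).target := by
  have : IsManifold 𝓘(ℝ, E) 1 M := IsManifold.of_le (n := ∞) (by simp)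
  have ho := isOpen_extChartAt_target (I := 𝓘(ℝ, E)) x₀
  have h1 := (contMDiffOn_extChartAt_symm (I := 𝓘(ℝ, E)) (n := ∞)
    x₀).contMDiffOn_tangentMapWithin (m := ∞) (by simp) ho.uniqueMDiffOn
  have h2 : ContMDiffOn 𝓘(ℝ, E) 𝓘(ℝ, E).tangent ∞
      (fun y => (⟨y, u⟩ : TangentBundle 𝓘(ℝ, E) E)) (extChartAt 𝓘(ℝ, E) x₀).target :=
    fun y _ => contMDiffWithinAt_vectorSpace_iff_contDiffWithinAt.2 contDiffWithinAt_const
  refine (h1.comp h2 fun y hy => hy).congr fun y hy => ?_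
  simp only [Function.comp_def, tangentMapWithin, mfderivWithin_of_isOpen ho hy]

theorem contMDiffOn_mfderiv_extChartAt (x₀ : M) {s : Set E} {p : E → M}
    {v : (y : E) → TangentSpace 𝓘(ℝ, E) (p y)} (hp : ∀ y ∈ s, p y ∈ (extChartAt 𝓘(ℝ, E) x₀).source)
    (hv : ContMDiffOn 𝓘(ℝ, E) 𝓘(ℝ, E).tangent ∞
      (fun y => (⟨p y, v y⟩ : TangentBundle 𝓘(ℝ, E) M)) s) :
    ContDiffOn ℝ ∞ (fun y => (mfderiv 𝓘(ℝ, E) 𝓘(ℝ, E) (extChartAt 𝓘(ℝ, E) x₀) (p y) (v y) : E))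
      s := by
  have : IsManifold 𝓘(ℝ, E) 1 M := IsManifold.of_le (n := ∞) (by simp)
  have ho := isOpen_extChartAt_source (I := 𝓘(ℝ, E)) x₀
  have h0 : ContMDiffOn 𝓘(ℝ, E) 𝓘(ℝ, E) ∞ (extChartAt 𝓘(ℝ, E) x₀)
      (extChartAt 𝓘(ℝ, E) x₀).source := by
    rw [extChartAt_source]
    exact contMDiffOn_extChartAt
  have h1 := h0.contMDiffOn_tangentMapWithin (m := ∞) (by simp) ho.uniqueMDiffOn
  have h2 := (contMDiff_snd_tangentBundle_modelSpace E 𝓘(ℝ, E) (n := ∞)).comp_contMDiffOn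
    (h1.comp hv fun y hy => hp y hy)
  refine (contMDiffOn_iff_contDiffOn.1 h2).congr fun y hy => ?_
  have h3 := mfderivWithin_of_isOpen (I := 𝓘(ℝ, E)) (I' := 𝓘(ℝ, E))
    (f := extChartAt 𝓘(ℝ, E) x₀) ho (hp y hy)
  exact (DFunLike.congr_fun h3 (v y)).symm

theorem mfderiv_extChartAt_mfderiv_symm (x₀ : M) {y : E}
    (hy : y ∈ (extChartAt 𝓘(ℝ, E) x₀).target) (u : E) :
    (mfderiv 𝓘(ℝ, E) 𝓘(ℝ, E) (extChartAt 𝓘(ℝ, E) x₀) ((extChartAt 𝓘(ℝ, E) x₀).symm y)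
      (mfderiv 𝓘(ℝ, E) 𝓘(ℝ, E) (extChartAt 𝓘(ℝ, E) x₀).symm y u) : E) = u := by
  have : IsManifold 𝓘(ℝ, E) 1 M := IsManifold.of_le (n := ∞) (by simp)
  have h := mfderiv_extChartAt_comp_mfderivWithin_extChartAt_symm (I := 𝓘(ℝ, E)) hy
  simp only [ModelWithCorners.range_eq_univ, mfderivWithin_univ] at h
  exact DFunLike.congr_fun h u

theorem mfderiv_symm_mfderiv_extChartAt (x₀ : M) {y : E}
    (hy : y ∈ (extChartAt 𝓘(ℝ, E) x₀).target)
    (v : TangentSpace 𝓘(ℝ, E) ((extChartAt 𝓘(ℝ, E) x₀).symm y)) :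
    mfderiv 𝓘(ℝ, E) 𝓘(ℝ, E) (extChartAt 𝓘(ℝ, E) x₀).symm y
      (mfderiv 𝓘(ℝ, E) 𝓘(ℝ, E) (extChartAt 𝓘(ℝ, E) x₀) ((extChartAt 𝓘(ℝ, E) x₀).symm y) v) =
      v := by
  have : IsManifold 𝓘(ℝ, E) 1 M := IsManifold.of_le (n := ∞) (by simp)
  have h := mfderivWithin_extChartAt_symm_comp_mfderiv_extChartAt (I := 𝓘(ℝ, E)) hy
  simp only [ModelWithCorners.range_eq_univ, mfderivWithin_univ] at h
  exact DFunLike.congr_fun h v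

variable [FiniteDimensional ℝ E] [RiemannianBundle (fun x : M => TangentSpace 𝓘(ℝ, E) x)]

variable [IsContMDiffRiemannianBundle 𝓘(ℝ, E) ∞ E (fun x : M => TangentSpace 𝓘(ℝ, E) x)]

theorem isMetricOn_chartMetric (x₀ : M) :
    LocalGeometry.IsMetricOn (chartMetric (E := E) x₀) (extChartAt 𝓘(ℝ, E) x₀).target where
  isOpen := isOpen_extChartAt_target x₀
  contDiffOn := by
    refine contDiffOn_clm_apply.2 fun u => contDiffOn_clm_apply.2 fun v => ?_
    simp only [chartMetric_apply]
    exact contMDiffOn_iff_contDiffOn.1 (ContMDiffOn.inner_bundle (F := E)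
      (E := fun x : M => TangentSpace 𝓘(ℝ, E) x) (IB := 𝓘(ℝ, E))
      (b := fun y => (extChartAt 𝓘(ℝ, E) x₀).symm y)
      (contMDiffOn_mfderiv_extChartAt_symm x₀ u) (contMDiffOn_mfderiv_extChartAt_symm x₀ v))
  symm y _ u v := by
    rw [chartMetric_apply, chartMetric_apply]
    exact real_inner_comm _ _
  pos y hy u hu := by
    rw [chartMetric_apply]
    refine real_inner_self_pos.2 fun h0 => hu ?_
    rw [← mfderiv_extChartAt_mfderiv_symm x₀ hy u, h0]
    exact map_zero _

theorem isKaehlerOn_chart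
    {J : (x : M) → TangentSpace 𝓘(ℝ, E) x →L[ℝ] TangentSpace 𝓘(ℝ, E) x}
    (hJ : IsSmoothEndo J) (hsq : ∀ x u, J x (J x u) = -u)
    (hor : ∀ x u v, inner ℝ (J x u) (J x v) = inner ℝ u v) (x₀ : M)
    (hnij : ∀ y ∈ (extChartAt 𝓘(ℝ, E) x₀).target, ∀ u v : E,
      LocalGeometry.nijenhuis (chartEndo J x₀) y u v = 0)
    (hcl : ∀ y ∈ (extChartAt 𝓘(ℝ, E) x₀).target, ∀ u v w : E,
      LocalGeometry.extDerivTwoForm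
        (LocalGeometry.fundamentalForm (chartMetric x₀) (chartEndo J x₀)) y u v w = 0) :
    LocalGeometry.IsKaehlerOn (chartMetric (E := E) x₀) (chartEndo J x₀)
      (extChartAt 𝓘(ℝ, E) x₀).target where
  toIsMetricOn := isMetricOn_chartMetric x₀
  contDiffOn_endo := by
    refine contDiffOn_clm_apply.2 fun u => ?_
    simp only [chartEndo_apply]
    refine contMDiffOn_mfderiv_extChartAt x₀ (fun y hy => (extChartAt 𝓘(ℝ, E) x₀).map_target hy) ?_
    have h1 := contMDiffOn_mfderiv_extChartAt_symm x₀ u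
    have h2 := ContMDiff.comp_contMDiffOn hJ (contMDiffOn_extChartAt_symm (n := ∞) x₀)
    exact h2.clm_bundle_apply h1
  sq y hy u := by
    rw [chartEndo_apply, chartEndo_apply, mfderiv_symm_mfderiv_extChartAt x₀ hy, hsq, map_neg,
      mfderiv_extChartAt_mfderiv_symm x₀ hy]
    rfl
  orthogonal y hy u v := by
    have h := fun u => mfderiv_symm_mfderiv_extChartAt x₀ hy
      (J _ (mfderiv 𝓘(ℝ, E) 𝓘(ℝ, E) (extChartAt 𝓘(ℝ, E) x₀).symm y u))
    exact (congrArg₂ (fun a b => inner ℝ a b) (h u) (h v)).trans (hor _ _ _)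
  integrable := hnij
  closed := hcl

end RiemannianGeometry

/-! ### The curvature tensor at the base point of a chart -/

namespace RiemannianGeometry

variable {E : Type*} [NormedAddCommGroup E] [NormedSpace ℝ E]
  {M : Type*} [TopologicalSpace M] [ChartedSpace E M]

/-- The derivative at `x` of the chart at `x`. -/
noncomputable def chartDeriv (x : M) : TangentSpace 𝓘(ℝ, E) x →L[ℝ] E :=
  mfderiv 𝓘(ℝ, E) 𝓘(ℝ, E) (extChartAt 𝓘(ℝ, E) x) x

/-- The derivative at the image of `x` of the inverse of the chart at `x`. -/
noncomputable def chartSymmDeriv (x : M) : E →L[ℝ] TangentSpace 𝓘(ℝ, E) x :=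
  mfderiv 𝓘(ℝ, E) 𝓘(ℝ, E) (extChartAt 𝓘(ℝ, E) x).symm (extChartAt 𝓘(ℝ, E) x x)

theorem curvatureTensor_apply [RiemannianBundle (fun x : M => TangentSpace 𝓘(ℝ, E) x)]
    (x : M) (u v w : TangentSpace 𝓘(ℝ, E) x) :
    curvatureTensor x u v w = chartSymmDeriv x (LocalGeometry.riemann (chartMetric x)
      (extChartAt 𝓘(ℝ, E) x x) (chartDeriv x u) (chartDeriv x v) (chartDeriv x w)) := rfl

theorem inner_chartSymmDeriv [RiemannianBundle (fun x : M => TangentSpace 𝓘(ℝ, E) x)]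
    (x : M) (u v : E) :
    inner ℝ (chartSymmDeriv x u) (chartSymmDeriv x v) =
      chartMetric x (extChartAt 𝓘(ℝ, E) x x) u v := by
  -- The chart followed by its inverse fixes x only up to a propositional equality. All tangent
  -- spaces unfold to `E`, so the base point can be substituted with the vectors kept in `E`.
  have key : ∀ (p : M) (_ : p = x) (a b : E), inner ℝ (E := TangentSpace 𝓘(ℝ, E) x) a b =
      inner ℝ (E := TangentSpace 𝓘(ℝ, E) p) a b := by
    rintro p rfl a b
    rfl
  exact key _ (extChartAt_to_inv (I := 𝓘(ℝ, E)) x) _ _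

theorem chartEndo_self (J : (x : M) → TangentSpace 𝓘(ℝ, E) x →L[ℝ] TangentSpace 𝓘(ℝ, E) x)
    (x : M) (u : E) :
    chartEndo J x (extChartAt 𝓘(ℝ, E) x x) u = chartDeriv x (J x (chartSymmDeriv x u)) := by
  have key : ∀ (p : M) (_ : p = x) (a : E),
      (mfderiv 𝓘(ℝ, E) 𝓘(ℝ, E) (extChartAt 𝓘(ℝ, E) x) p (J p a) : E) =
        mfderiv 𝓘(ℝ, E) 𝓘(ℝ, E) (extChartAt 𝓘(ℝ, E) x) x (J x a) := by
    rintro p rfl a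
    rfl
  exact key _ (extChartAt_to_inv (I := 𝓘(ℝ, E)) x) _

variable [IsManifold 𝓘(ℝ, E) ∞ M]

theorem chartSymmDeriv_chartDeriv (x : M) (v : TangentSpace 𝓘(ℝ, E) x) :
    chartSymmDeriv x (chartDeriv x v) = v := by
  have : IsManifold 𝓘(ℝ, E) 1 M := IsManifold.of_le (n := ∞) (by simp)
  have h := mfderivWithin_extChartAt_symm_comp_mfderiv_extChartAt' (I := 𝓘(ℝ, E))
    (mem_extChartAt_source (I := 𝓘(ℝ, E)) x)
  simp only [ModelWithCorners.range_eq_univ, mfderivWithin_univ] at h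
  exact DFunLike.congr_fun h v

variable [FiniteDimensional ℝ E] [RiemannianBundle (fun x : M => TangentSpace 𝓘(ℝ, E) x)]
  [IsContMDiffRiemannianBundle 𝓘(ℝ, E) ∞ E (fun x : M => TangentSpace 𝓘(ℝ, E) x)]

/-- The curvature tensor of a Kähler manifold has the Kähler symmetries. -/
theorem IsKaehler.isKaehlerCurvature (hK : IsKaehler E M) (x : M) :
    ∃ J : TangentSpace 𝓘(ℝ, E) x →ₗ[ℝ] TangentSpace 𝓘(ℝ, E) x,
      SecondKind.IsKaehlerCurvature (curvatureTensor (E := E) x) J := by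
  obtain ⟨J, hJ, hsq, hor, hnij, hcl⟩ := hK
  have hL := isKaehlerOn_chart hJ hsq hor x (hnij x) (hcl x)
  have hy := mem_extChartAt_target (I := 𝓘(ℝ, E)) x
  have hM := hL.toIsMetricOn
  refine ⟨(J x).toLinearMap, ?_⟩
  constructor
  · intro u v w
    rw [curvatureTensor_apply, LocalGeometry.riemann_antisymm, map_neg]
    rfl
  · intro u v w z
    have hin : ∀ a (z : TangentSpace 𝓘(ℝ, E) x), inner ℝ (chartSymmDeriv x a) z =
        chartMetric x (extChartAt 𝓘(ℝ, E) x x) a (chartDeriv x z) := fun a z => by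
      rw [← inner_chartSymmDeriv, chartSymmDeriv_chartDeriv]
    rw [curvatureTensor_apply, curvatureTensor_apply, hin, hin, hM.riemann_skew hy]
  · intro u v w
    have h := hM.riemann_bianchi hy (chartDeriv x u) (chartDeriv x v) (chartDeriv x w)
    rw [curvatureTensor_apply, curvatureTensor_apply, curvatureTensor_apply, ← map_add, ← map_add,
      h, map_zero]
  · exact hsq x
  · exact hor x
  · intro u v w
    have h := hL.riemann_endo hy (chartDeriv x u) (chartDeriv x v) (chartDeriv x w)
    rw [chartEndo_self, chartEndo_self, chartSymmDeriv_chartDeriv] at h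
    change curvatureTensor x u v (J x w) = J x (curvatureTensor x u v w)
    rw [curvatureTensor_apply, curvatureTensor_apply, h, chartSymmDeriv_chartDeriv]

end RiemannianGeometry

/-! ### Comparison of the bounds and conclusion -/

/-- For even m this amounts to (m−2)(m+1) ≥ 0, with equality at m = 2; for odd m there is a further
factor (m²−1)/(m²+1) < 1. -/
theorem kaehlerBound_le {m : ℕ} (hm : 2 ≤ m) : kaehlerBound m ≤ 3 / 2 * ((m : ℝ) ^ 2 - 1) := by
  have hm' : (2 : ℝ) ≤ m := by exact_mod_cast hm
  have h1 : 3 * (m : ℝ) * ((m + 1) / (m + 2)) ≤ 3 / 2 * ((m : ℝ) ^ 2 - 1) := by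
    rw [← mul_div_assoc, div_le_iff₀ (by positivity)]
    nlinarith [mul_nonneg (by linarith : (0 : ℝ) ≤ m + 1)
      (mul_nonneg (by linarith : (0 : ℝ) ≤ m - 2) (by linarith : (0 : ℝ) ≤ m + 1))]
  unfold kaehlerBound
  split_ifs
  · exact h1
  · refine le_trans ?_ h1
    refine mul_le_mul_of_nonneg_left ?_ (by positivity)
    rw [div_le_div_iff₀ (by positivity) (by positivity)]
    nlinarith [mul_nonneg (by linarith : (0 : ℝ) ≤ m + 1) (by linarith : (0 : ℝ) ≤ m + 2)]

/-- The bound is 0 for m = 0 and m = 1, so no positive k lies below it there. -/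
theorem two_le_of_kaehlerBound_pos {m : ℕ} (h : 0 < kaehlerBound m) : 2 ≤ m := by
  by_contra hm
  interval_cases m <;> simp [kaehlerBound] at h

theorem theoremC (m : ℕ) {M : Type*} [TopologicalSpace M]
    [ChartedSpace (EuclideanSpace ℝ (Fin (2 * m))) M] [IsManifold (𝓡 (2 * m)) ∞ M]
    [RiemannianBundle (fun x : M => TangentSpace (𝓡 (2 * m)) x)]
    [IsContMDiffRiemannianBundle (𝓡 (2 * m)) ∞ (EuclideanSpace ℝ (Fin (2 * m)))
      (fun x : M => TangentSpace (𝓡 (2 * m)) x)]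
    (hK : RiemannianGeometry.IsKaehler (EuclideanSpace ℝ (Fin (2 * m))) M)
    (k : ℝ) (hk : 0 < k) (hkm : k < kaehlerBound m)
    (hR : RiemannianGeometry.HasKNonnegSecondKind (EuclideanSpace ℝ (Fin (2 * m))) M k ∨
      RiemannianGeometry.HasKNonposSecondKind (EuclideanSpace ℝ (Fin (2 * m))) M k) :
    RiemannianGeometry.IsFlat (EuclideanSpace ℝ (Fin (2 * m))) M := by
  intro x
  have hm : 2 ≤ m := two_le_of_kaehlerBound_pos (hk.trans hkm)
  obtain ⟨J, hJ⟩ := hK.isKaehlerCurvature x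
  refine hJ.eq_zero hm ?_ hk (hkm.trans_le (kaehlerBound_le hm)) (hR.imp (fun h => h x) fun h => h x)
  exact finrank_euclideanSpace_fin
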